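/- Call a function $f:\mathbb N\to\mathbb R_{\ge 0}$ negligible if $\lambda^{k}f(\lambda)\to 0$ as $\lambda\to\infty$ for every $k\in\mathbb N$. "QPT" means uniform quantum polynomial time: a polynomial-time Turing machine, on input $1^\lambda$, writes down the quantum circuit (over a fixed universal gate set) used for security parameter $\lambda$. A canonical quantum bit commitment scheme is a family $\{Q_0(\lambda),Q_1(\lambda)\}_{\lambda\in\mathbb N}$ of efficiently implementable unitaries (their circuits are written down by a polynomial-time Turing machine on input $1^\lambda$) on two registers, the reveal register $\mathbf R$ and the commitment register $\mathbf C$. To commit to $b\in\{0,1\}$ the sender prepares $|\Psi_b\rangle_{\mathbf R,\mathbf C}=Q_b(\lambda)|0\cdots 0\rangle$ and sends $\mathbf C$. To reveal, the sender sends $\mathbf R$ and $b$; the receiver applies $Q_b(\lambda)^\dagger$, measures all qubits in the computational basis, and accepts $b$ iff all results are $0$. Let $\rho_b=\mathrm{Tr}_{\mathbf R}|\Psi_b\rangle\langle\Psi_b|$. The scheme is computationally hiding if for every QPT adversary $\mathcal A$ the function $\bigl|\Pr[1\leftarrow\mathcal A(1^\lambda,\rho_0)]-\Pr[1\leftarrow\mathcal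 A(1^\lambda,\rho_1)]\bigr|$ is negligible. It is computationally binding if every QPT adversary wins the following game with negligible probability: it commits honestly to $0$, applies any (QPT) operation to $\mathbf R$ (possibly with its own ancilla qubits), and opens the commitment to $1$; it wins iff the receiver accepts $1$. Theorem. (i) There is no canonical quantum bit commitment scheme that is both computationally binding and computationally hiding and whose commitment register $\mathbf C$ has $O(\log\lambda)$ qubits. (ii) There is no canonical quantum bit commitment scheme that is both computationally binding and computationally hiding and whose reveal register $\mathbf R$ has $O(\log\lambda)$ qubits. -/

import Mathlib

namespace QBC

noncomputable section

/-! ## Gates and circuits -/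

/-- Vectors on a register with set of qubits `W`, in the computational basis. -/
abbrev Ket (W : Type) := (W → Bool) → ℂ

/-- Operators (unitaries, density operators) on a register with set of qubits `W`. -/
abbrev Op (W : Type) := Matrix (W → Bool) (W → Bool) ℂ

/-- The basis vector `|0...0⟩`. -/
def ket0 (W : Type) : Ket W :=
  open Classical in fun x => if x = fun _ => false then 1 else 0

/-- The rank-one operator `|ψ⟩⟨ψ|`. -/
def pureState {W : Type} (ψ : Ket W) : Op W :=
  fun x y => ψ x * star (ψ y)

/-- The operator `M`, acting on the qubits `ι v` (`v : V`) of the register `W`, tensored with the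
identity on all other qubits of `W`. Used for injective `ι` only. -/
def onQubits {V W : Type} (ι : V → W) (M : Op V) : Op W :=
  open Classical in
  fun x y => if ∀ w, w ∉ Set.range ι → x w = y w then M (fun v => x (ι v)) (fun v => y (ι v)) else 0

/-- The tensor product `ρ ⊗ σ` of an operator on `V` with an operator on `W`. -/
def tensor {V W : Type} (ρ : Op V) (σ : Op W) : Op (V ⊕ W) :=
  fun x y => ρ (fun v => x (Sum.inl v)) (fun v => y (Sum.inl v)) *
    σ (fun w => x (Sum.inr w)) (fun w => y (Sum.inr w))

/-- The partial trace over the second of two registers. -/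
def traceSnd {V W : Type} [Fintype W] [DecidableEq W] (ρ : Op (V ⊕ W)) : Op V :=
  fun x y => ∑ z : W → Bool, ρ (Sum.elim x z) (Sum.elim y z)

/-- The Hadamard gate. -/
def hadamardMatrix : Op (Fin 1) :=
  fun x y => (if (x 0 && y 0) = true then -1 else 1) / (Real.sqrt 2 : ℂ)

/-- The `T` gate, `diag (1, exp (iπ/4))`. -/
def tMatrix : Op (Fin 1) :=
  Matrix.diagonal fun x => if x 0 = true then Complex.exp (Real.pi / 4 * Complex.I) else 1

/-- The controlled NOT gate; qubit `0` is the control. -/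
def cnotMatrix : Op (Fin 2) :=
  fun x y => if x = ![y 0, xor (y 0) (y 1)] then 1 else 0

/-- The Toffoli gate; qubits `0` and `1` are the controls. -/
def toffoliMatrix : Op (Fin 3) :=
  fun x y => if x = ![y 0, y 1, xor (y 0 && y 1) (y 2)] then 1 else 0

/-- Elementary instructions over the universal gate set `{H, T, CNOT, Toffoli}`, each with the names
of the qubits that it acts on (for the last two, the target comes last). -/
inductive Gate (W : Type) : Type
  | had (q : W)
  | tee (q : W)
  | cnot (p q : W)
  | toffoli (o p q : W)

/-- The unitary operator of an instruction. An instruction that repeats a qubit does nothing. -/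
def Gate.op {W : Type} : Gate W → Op W
  | .had q => onQubits ![q] hadamardMatrix
  | .tee q => onQubits ![q] tMatrix
  | .cnot p q => open Classical in
      if Function.Injective ![p, q] then onQubits ![p, q] cnotMatrix else 1
  | .toffoli o p q => open Classical in
      if Function.Injective ![o, p, q] then onQubits ![o, p, q] toffoliMatrix else 1

/-- The unitary operator of a circuit, whose first instruction is applied first. -/
def circuitOp {W : Type} [Fintype W] [DecidableEq W] : List (Gate W) → Op W
  | [] => 1
  | g :: gs => circuitOp gs * g.op

/-! ## Descriptions of circuits

The circuits act on two registers. In a description, `Sum.inl i` names qubit `i` of the first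
register and `Sum.inr i` names qubit `i` of the second. -/

/-- The qubit with a given name, if the registers have `m` and `n` qubits. -/
def qubitOf (m n : ℕ) : ℕ ⊕ ℕ → Option (Fin m ⊕ Fin n)
  | .inl i => if h : i < m then some (.inl ⟨i, h⟩) else none
  | .inr i => if h : i < n then some (.inr ⟨i, h⟩) else none

/-- The instruction, on registers with `m` and `n` qubits, with a given description; there is none if
the description names a qubit that does not exist. -/
def gateOf (m n : ℕ) : Gate (ℕ ⊕ ℕ) → Option (Gate (Fin m ⊕ Fin n))
  | .had q => (qubitOf m n q).map .had
  | .tee q => (qubitOf m n q).map .tee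
  | .cnot p q => (qubitOf m n p).bind fun p' => (qubitOf m n q).map fun q' => .cnot p' q'
  | .toffoli o p q => (qubitOf m n o).bind fun o' => (qubitOf m n p).bind fun p' =>
      (qubitOf m n q).map fun q' => .toffoli o' p' q'

/-- The unitary, on registers with `m` and `n` qubits, of a description of a circuit. Instructions
that name a qubit that does not exist are skipped. -/
def unitaryOf (m n : ℕ) (gs : List (Gate (ℕ ⊕ ℕ))) : Op (Fin m ⊕ Fin n) :=
  circuitOp (gs.filterMap (gateOf m n))

/-- The finite alphabet in which descriptions of circuits are written. -/
inductive Letter : Type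
  | tick | sep | fst | snd | had | tee | cnot | toffoli
  deriving DecidableEq

instance : Fintype Letter where
  elems := {.tick, .sep, .fst, .snd, .had, .tee, .cnot, .toffoli}
  complete := by intro x; cases x <;> decide

/-- A number in unary. -/
def encodeNat (n : ℕ) : List Letter := List.replicate n .tick

/-- A qubit: its index in unary, then the name of its register. -/
def encodeQubit : ℕ ⊕ ℕ → List Letter
  | .inl i => encodeNat i ++ [.fst]
  | .inr i => encodeNat i ++ [.snd]

/-- An instruction: the name of the gate, then its qubits. -/
def encodeGate : Gate (ℕ ⊕ ℕ) → List Letter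
  | .had q => .had :: encodeQubit q
  | .tee q => .tee :: encodeQubit q
  | .cnot p q => .cnot :: (encodeQubit p ++ encodeQubit q)
  | .toffoli o p q => .toffoli :: (encodeQubit o ++ encodeQubit p ++ encodeQubit q)

/-- A circuit, as a word over `Letter`. -/
def encodeCircuit (gs : List (Gate (ℕ ⊕ ℕ))) : List Letter := gs.flatMap encodeGate

/-- `f` is computed by a Turing machine in time polynomial in `n` on input `1ⁿ`, the values of `f`
being written in the encoding `e`. -/
def PolyTime {α : Type} (e : α → List Letter) (f : ℕ → α) : Prop :=
  Nonempty (Turing.TM2ComputableInPolyTime Computability.unaryEncodeNat e f)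

/-! ## Uniform quantum polynomial time algorithms -/

/-- The description of a quantum circuit that acts on an input register (its first register) and on a
work register (its second register) with `work + 1` qubits, initialized to `|0...0⟩`. -/
structure AlgDesc : Type where
  work : ℕ
  circuit : List (Gate (ℕ ⊕ ℕ))

/-- An `AlgDesc`, as a word over `Letter`. -/
def AlgDesc.encode (d : AlgDesc) : List Letter :=
  encodeNat d.work ++ [.sep] ++ encodeCircuit d.circuit

/-- A uniform QPT algorithm with quantum input: a polynomial time Turing machine writes down, on
input `1^n`, the circuit that is used for the security parameter `n`. -/
structure QPTAlgorithm : Type where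
  desc : ℕ → AlgDesc
  polyTime : PolyTime AlgDesc.encode desc

namespace QPTAlgorithm

variable (A : QPTAlgorithm)

/-- The work register. -/
abbrev Work (n : ℕ) : Type := Fin ((A.desc n).work + 1)

/-- The unitary that is applied to an `m`-qubit input and the work register. -/
def unitary (n m : ℕ) : Op (Fin m ⊕ A.Work n) :=
  unitaryOf m ((A.desc n).work + 1) (A.desc n).circuit

/-- `Pr[1 ← A(1^n, ρ)]`, the probability that measuring qubit `0` of the work register in the end
yields `1`. -/
def prOne (n : ℕ) {m : ℕ} (ρ : Op (Fin m)) : ℝ :=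
  let σ : Op (Fin m ⊕ A.Work n) :=
    A.unitary n m * tensor ρ (pureState (ket0 (A.Work n))) * (A.unitary n m).conjTranspose
  ∑ x : (Fin m ⊕ A.Work n) → Bool, if x (Sum.inr 0) = true then (σ x x).re else 0

end QPTAlgorithm

/-! ## Canonical quantum bit commitments -/

/-- The description of the two unitaries `Q₀` and `Q₁` (for `b = false` and `b = true`) of a canonical
quantum bit commitment. They act on a commitment register `C` (the first register), with `commit`
qubits, and a reveal register `R` (the second register), with `reveal` qubits. -/
structure CommitmentDesc : Type where
  commit : ℕ
  reveal : ℕ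
  circuit : Bool → List (Gate (ℕ ⊕ ℕ))

/-- A `CommitmentDesc`, as a word over `Letter`. -/
def CommitmentDesc.encode (d : CommitmentDesc) : List Letter :=
  encodeNat d.commit ++ [.sep] ++ encodeNat d.reveal ++ [.sep] ++
    encodeCircuit (d.circuit false) ++ [.sep] ++ encodeCircuit (d.circuit true)

/-- A canonical quantum bit commitment scheme: a family `{Q₀(n), Q₁(n)}` of efficiently implementable
unitaries, i.e., unitaries whose circuits are written down by a polynomial time Turing machine on
input `1^n`. -/
structure CommitmentScheme : Type where
  desc : ℕ → CommitmentDesc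
  polyTime : PolyTime CommitmentDesc.encode desc

namespace CommitmentScheme

variable (S : CommitmentScheme)

/-- The number of qubits of the commitment register. -/
def commitLength (n : ℕ) : ℕ := (S.desc n).commit

/-- The number of qubits of the reveal register. -/
def revealLength (n : ℕ) : ℕ := (S.desc n).reveal

/-- The commitment register `C`. -/
abbrev C (n : ℕ) : Type := Fin (S.commitLength n)

/-- The reveal register `R`. -/
abbrev R (n : ℕ) : Type := Fin (S.revealLength n)

/-- The unitary `Q_b(n)`. -/
def Q (b : Bool) (n : ℕ) : Op (S.C n ⊕ S.R n) :=
  unitaryOf (S.commitLength n) (S.revealLength n) ((S.desc n).circuit b)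

/-- The state `|Ψ_b⟩ = Q_b(n)|0...0⟩` that an honest sender generates. -/
def Ψ (b : Bool) (n : ℕ) : Ket (S.C n ⊕ S.R n) :=
  (S.Q b n).mulVec (ket0 (S.C n ⊕ S.R n))

/-- The state `ρ_b = Tr_R |Ψ_b⟩⟨Ψ_b|` of the commitment register. -/
def committedState (b : Bool) (n : ℕ) : Op (S.C n) :=
  traceSnd (pureState (S.Ψ b n))

/-- The probability that the receiver, who holds both registers in the state `σ`, accepts `b`: apply
`Q_b†`, measure all qubits, and accept if all results are `0`. -/
def prAccept (b : Bool) (n : ℕ) (σ : Op (S.C n ⊕ S.R n)) : ℝ :=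
  (((S.Q b n).conjTranspose * σ * S.Q b n) (fun _ => false) (fun _ => false)).re

/-- The state of the registers `C` and `R` after `A` committed honestly to `0` and then applied its
operation to the register `R`: its unitary acts on `R` and on its work register, which is traced out
afterwards. -/
def attackedState (A : QPTAlgorithm) (n : ℕ) : Op (S.C n ⊕ S.R n) :=
  let U : Op ((S.C n ⊕ S.R n) ⊕ A.Work n) :=
    onQubits (Sum.map Sum.inr id) (A.unitary n (S.revealLength n))
  traceSnd (U * tensor (pureState (S.Ψ false n)) (pureState (ket0 (A.Work n))) * U.conjTranspose)

/-- The probability that `A` wins the binding game: after an honest commitment to `0`, it opens the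
commitment to `1`. -/
def prWin (A : QPTAlgorithm) (n : ℕ) : ℝ :=
  S.prAccept true n (S.attackedState A n)

end CommitmentScheme

/-- A function of the security parameter is negligible if it tends to zero faster than any inverse
polynomial. -/
def Negligible (f : ℕ → ℝ) : Prop :=
  Asymptotics.SuperpolynomialDecay Filter.atTop (fun n : ℕ => (n : ℝ)) f

/-- Computational hiding, against uniform QPT adversaries. -/
def CommitmentScheme.ComputationallyHiding (S : CommitmentScheme) : Prop :=
  ∀ A : QPTAlgorithm, Negligible fun n =>
    |A.prOne n (S.committedState false n) - A.prOne n (S.committedState true n)|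

/-- Computational (honest) binding, against uniform QPT adversaries. -/
def CommitmentScheme.ComputationallyBinding (S : CommitmentScheme) : Prop :=
  ∀ A : QPTAlgorithm, Negligible fun n => S.prWin A n

/-- `f(n) = O(log n)`. -/
def IsLogarithmic (f : ℕ → ℕ) : Prop :=
  (fun n => (f n : ℝ)) =O[Filter.atTop] fun n : ℕ => Real.log n

end

end QBC

set_option linter.unusedSectionVars false

namespace QBC

open Matrix

/-! ## Operators on some of the qubits of a register -/

section OnQubits

variable {V W X : Type} [Fintype V] [DecidableEq V] [Fintype W] [DecidableEq W]
  [Fintype X] [DecidableEq X]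

/-! Write `ρ_b` for the reduced state of `Ψ_b` on the register `C`. The proof plays two quantities
against each other: the purity `tr (ρ_1 ^ 2)` and the overlap `tr (ρ_0 ρ_1)`.

The two marginals of a pure bipartite state have the same purity (`sum_normSq_gram_comm`), and a
state of `d` qubits has purity at least `2 ^ (-d)`. Hence if either `C` or `R` has `O(log n)`
qubits, the purity of `ρ_1` is at least an inverse polynomial, and both parts of the theorem follow
from one argument.

Hiding: a swap test between the challenge `ρ_b` and a fresh copy of `ρ_1`, prepared by running
`Q_1`, outputs `1` with probability `(1 - tr (ρ_b ρ_1)) / 2` (`prob_exchangeTest`). So hiding forces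
`tr (ρ_1 ^ 2) - tr (ρ_0 ρ_1)` to be negligible, and the overlap is bounded below by an inverse
polynomial as well.

Binding: after committing to `0`, the sender prepares a fresh `Ψ_1` and replaces `R` by the reveal
register of that copy. The projection on `Ψ_1` then leaves the vector `(ρ_1 ⊗ 1) Ψ_0`, whose squared
norm is at least `⟨Ψ_0, (ρ_1 ⊗ 1) Ψ_0⟩ ^ 2 = tr (ρ_0 ρ_1) ^ 2` by Cauchy–Schwarz. Using the
controlled exchange of the swap test instead of a plain exchange costs only a factor `2`
(`overlap_sq_le_prob`) and lets one circuit serve as both attacks. Binding would make this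
negligible, a contradiction (`not_negligible_of_isLogarithmic`).

Adversaries are uniform, so the attack circuit must itself be written by a polynomial time Turing
machine. `attackMachine` runs the machine of the scheme and then translates its output letter by
letter, with counters for the lengths of the two registers. The new qubit names are chosen so that
the translation never has to check whether a qubit exists. -/

theorem sum_agree_off_range {ι : V → W} (hι : Function.Injective ι) (x : W → Bool)
    {E : Type} [AddCommMonoid E] (f : (W → Bool) → E)
    [DecidablePred fun y : W → Bool => ∀ w, w ∉ Set.range ι → x w = y w] :
    (∑ y : W → Bool, if ∀ w, w ∉ Set.range ι → x w = y w then f y else 0) =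
      ∑ v : V → Bool, f (Function.extend ι v x) := by
  rw [← Finset.sum_filter]
  symm
  refine Finset.sum_bij' (fun v _ => Function.extend ι v x) (fun y _ => y ∘ ι) ?_ ?_ ?_ ?_ ?_
  · intro v _
    simp only [Finset.mem_filter, Finset.mem_univ, true_and]
    intro w hw
    rw [Function.extend_apply' _ _ _ (by simpa using hw)]
  · intros; simp
  · intro v _
    funext u
    simp [hι.extend_apply]
  · intro y hy
    simp only [Finset.mem_filter, Finset.mem_univ, true_and] at hy
    funext w
    by_cases hw : w ∈ Set.range ι
    · obtain ⟨u, rfl⟩ := hw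
      simp [hι.extend_apply]
    · rw [Function.extend_apply' _ _ _ (by simpa using hw), hy w hw]
  · intros; rfl

/-- With the bits outside the range of `ι` frozen at those of `x`, only `M` acts. All later
identities for `onQubits` are derived from this pointwise form. -/
theorem onQubits_mulVec {ι : V → W} (hι : Function.Injective ι) (M : Op V) (ψ : Ket W)
    (x : W → Bool) :
    (onQubits ι M *ᵥ ψ) x = (M *ᵥ fun v => ψ (Function.extend ι v x)) (x ∘ ι) := by
  classical
  simp only [mulVec, dotProduct, onQubits, ite_mul, zero_mul]
  rw [sum_agree_off_range hι x fun y => M (fun v => x (ι v)) (fun v => y (ι v)) * ψ y]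
  refine Finset.sum_congr rfl fun v _ => ?_
  simp [hι.extend_apply, Function.comp_def]

theorem onQubits_one (ι : V → W) : onQubits ι (1 : Op V) = 1 := by
  classical
  ext x y
  by_cases h : x = y
  · subst h; simp [onQubits]
  · have : ¬ ((∀ w, w ∉ Set.range ι → x w = y w) ∧ (fun v => x (ι v)) = fun v => y (ι v)) := by
      rintro ⟨h₁, h₂⟩
      refine h (funext fun w => ?_)
      by_cases hw : w ∈ Set.range ι
      · obtain ⟨u, rfl⟩ := hw
        exact congrFun h₂ u
      · exact h₁ w hw
    simp only [onQubits, one_apply, h, if_false]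
    split_ifs <;> first | rfl | (exfalso; tauto)

theorem extend_extend {ι : V → W} (hι : Function.Injective ι) (u v : V → Bool) (x : W → Bool) :
    Function.extend ι u (Function.extend ι v x) = Function.extend ι u x := by
  funext w
  by_cases hw : ∃ a, ι a = w
  · obtain ⟨a, rfl⟩ := hw
    simp [hι.extend_apply]
  · simp [Function.extend_apply' _ _ _ hw]

theorem extend_comp_self {ι : V → W} (hι : Function.Injective ι) (u : V → Bool) (x : W → Bool) :
    Function.extend ι u x ∘ ι = u := by
  funext a
  simp [hι.extend_apply]

theorem onQubits_mul {ι : V → W} (hι : Function.Injective ι) (M N : Op V) :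
    onQubits ι (M * N) = onQubits ι M * onQubits ι N := by
  refine Matrix.ext_of_mulVec_single fun y => ?_
  rw [← mulVec_mulVec]
  funext x
  rw [onQubits_mulVec hι, onQubits_mulVec hι, ← mulVec_mulVec]
  have : (fun v => (onQubits ι N *ᵥ Pi.single y 1) (Function.extend ι v x)) =
      N *ᵥ fun v => (Pi.single y 1 : Ket W) (Function.extend ι v x) := by
    funext v
    rw [onQubits_mulVec hι, extend_comp_self hι]
    simp only [extend_extend hι]
  rw [this]

theorem onQubits_onQubits {ι : V → W} {κ : W → X} (hι : Function.Injective ι)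
    (hκ : Function.Injective κ) (M : Op V) :
    onQubits κ (onQubits ι M) = onQubits (κ ∘ ι) M := by
  refine Matrix.ext_of_mulVec_single fun y => ?_
  funext x
  rw [onQubits_mulVec hκ, onQubits_mulVec hι, onQubits_mulVec (hκ.comp hι)]
  have : ∀ v : V → Bool, Function.extend κ (Function.extend ι v (x ∘ κ)) x =
      Function.extend (κ ∘ ι) v x := by
    intro v
    funext w
    by_cases hw : ∃ a, κ a = w
    · obtain ⟨a, rfl⟩ := hw
      rw [hκ.extend_apply]
      by_cases ha : ∃ b, ι b = a
      · obtain ⟨b, rfl⟩ := ha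
        rw [hι.extend_apply]
        exact ((hκ.comp hι).extend_apply v x b).symm
      · rw [Function.extend_apply' _ _ _ ha, Function.extend_apply']
        · rfl
        · rintro ⟨b, hb⟩
          exact ha ⟨b, hκ hb⟩
    · rw [Function.extend_apply' _ _ _ hw, Function.extend_apply']
      rintro ⟨b, hb⟩
      exact hw ⟨_, hb⟩
  simp only [this]
  rfl

theorem onQubits_conjTranspose (ι : V → W) (M : Op V) :
    (onQubits ι M)ᴴ = onQubits ι Mᴴ := by
  classical
  ext x y
  simp only [onQubits, conjTranspose_apply]
  by_cases h : ∀ w, w ∉ Set.range ι → x w = y w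
  · rw [if_pos h, if_pos fun w hw => (h w hw).symm]
  · rw [if_neg h, if_neg fun h' => h fun w hw => (h' w hw).symm, star_zero]

theorem onQubits_isometry {ι : V → W} (hι : Function.Injective ι) {M : Op V} (hM : Mᴴ * M = 1) :
    (onQubits ι M)ᴴ * onQubits ι M = 1 := by
  rw [onQubits_conjTranspose, ← onQubits_mul hι, hM, onQubits_one]

end OnQubits

/-! ## Unitarity of circuits -/

theorem conjTranspose_mul_self_of_involution {V : Type} [Fintype V] [DecidableEq V]
    (f : (V → Bool) → V → Bool) (hf : Function.Involutive f) (M : Op V)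
    (hM : ∀ x y, M x y = if x = f y then 1 else 0) : Mᴴ * M = 1 := by
  ext x y
  simp only [mul_apply, conjTranspose_apply, hM, one_apply]
  by_cases h : x = y
  · simp [h]
  · rw [if_neg h]
    refine Finset.sum_eq_zero fun z _ => ?_
    by_cases hz : z = f x
    · rw [if_neg (c := z = f y) (by rintro h'; exact h (hf.injective (hz.symm.trans h'))), mul_zero]
    · simp [hz]

theorem hadamardMatrix_isometry : hadamardMatrixᴴ * hadamardMatrix = 1 := by
  ext x y
  have h2 : (Real.sqrt 2 : ℂ) * (Real.sqrt 2 : ℂ) = 2 := by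
    rw [← Complex.ofReal_mul, Real.mul_self_sqrt (by norm_num)]; norm_num
  have h3 : (Real.sqrt 2 : ℂ) ≠ 0 := by
    intro h; rw [h] at h2; norm_num at h2
  rw [mul_apply, ← (Equiv.funUnique (Fin 1) Bool).symm.sum_comp]
  have hx : x = fun _ => x 0 := by funext i; fin_cases i; rfl
  have hy : y = fun _ => y 0 := by funext i; fin_cases i; rfl
  rw [hx, hy]
  generalize x 0 = a
  generalize y 0 = b
  cases a <;> cases b <;> simp [hadamardMatrix, one_apply, funext_iff] <;> field_simp <;>
    (simp [pow_two, h2]; try norm_num)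

theorem tMatrix_isometry : tMatrixᴴ * tMatrix = 1 := by
  rw [tMatrix, diagonal_conjTranspose, diagonal_mul_diagonal, ← diagonal_one]
  congr 1
  funext x
  simp only [Pi.star_apply]
  split_ifs
  · rw [Complex.star_def, ← Complex.exp_conj, ← Complex.exp_add, map_mul, map_div₀,
      Complex.conj_ofReal, Complex.conj_I, map_ofNat]
    simp
  · simp

def cnotFun (y : Fin 2 → Bool) : Fin 2 → Bool := ![y 0, xor (y 0) (y 1)]

def toffoliFun (y : Fin 3 → Bool) : Fin 3 → Bool := ![y 0, y 1, xor (y 0 && y 1) (y 2)]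

theorem cnotFun_involutive : Function.Involutive cnotFun := by
  intro y
  funext i
  fin_cases i <;> simp [cnotFun]

theorem toffoliFun_involutive : Function.Involutive toffoliFun := by
  intro y
  funext i
  fin_cases i <;> simp [toffoliFun]

theorem Gate.op_cnot_of_not_injective {W : Type} [Fintype W] [DecidableEq W] {p q : W}
    (h : ¬ Function.Injective ![p, q]) : (Gate.cnot p q).op = 1 := by
  rw [Gate.op, if_neg h]
  -- The identity in the definition of `Gate.op` is built from classical decidable equality, so the
  -- two instances have to be identified.
  congr
  exact Subsingleton.elim _ _

theorem Gate.op_toffoli_of_not_injective {W : Type} [Fintype W] [DecidableEq W] {o p q : W}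
    (h : ¬ Function.Injective ![o, p, q]) : (Gate.toffoli o p q).op = 1 := by
  rw [Gate.op, if_neg h]
  congr
  exact Subsingleton.elim _ _

theorem Gate.op_isometry {W : Type} [Fintype W] [DecidableEq W] (g : Gate W) :
    g.opᴴ * g.op = 1 := by
  cases g with
  | had q =>
    exact onQubits_isometry (Function.injective_of_subsingleton _) hadamardMatrix_isometry
  | tee q => exact onQubits_isometry (Function.injective_of_subsingleton _) tMatrix_isometry
  | cnot p q =>
    by_cases h : Function.Injective ![p, q]
    · rw [Gate.op, if_pos h]
      exact onQubits_isometry h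
        (conjTranspose_mul_self_of_involution _ cnotFun_involutive _ fun _ _ => rfl)
    · simp [Gate.op_cnot_of_not_injective h]
  | toffoli o p q =>
    by_cases h : Function.Injective ![o, p, q]
    · rw [Gate.op, if_pos h]
      exact onQubits_isometry h
        (conjTranspose_mul_self_of_involution _ toffoliFun_involutive _ fun _ _ => rfl)
    · simp [Gate.op_toffoli_of_not_injective h]

theorem circuitOp_isometry {W : Type} [Fintype W] [DecidableEq W] (gs : List (Gate W)) :
    (circuitOp gs)ᴴ * circuitOp gs = 1 := by
  induction gs with
  | nil => simp [circuitOp]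
  | cons g gs ih =>
    rw [circuitOp, conjTranspose_mul, Matrix.mul_assoc, ← Matrix.mul_assoc _ (circuitOp gs), ih,
      Matrix.one_mul, g.op_isometry]

theorem circuitOp_append {W : Type} [Fintype W] [DecidableEq W] (gs hs : List (Gate W)) :
    circuitOp (gs ++ hs) = circuitOp hs * circuitOp gs := by
  induction gs with
  | nil => simp [circuitOp]
  | cons g gs ih => rw [List.cons_append, circuitOp, ih, circuitOp, Matrix.mul_assoc]

/-! ## Renaming the qubits of a circuit -/

/-- The instruction with its qubits renamed. -/
def Gate.map {V W : Type} (f : V → W) : Gate V → Gate W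
  | .had q => .had (f q)
  | .tee q => .tee (f q)
  | .cnot p q => .cnot (f p) (f q)
  | .toffoli o p q => .toffoli (f o) (f p) (f q)

theorem Gate.op_map {V W : Type} [Fintype V] [DecidableEq V] [Fintype W] [DecidableEq W]
    {ι : V → W} (hι : Function.Injective ι) (g : Gate V) :
    (g.map ι).op = onQubits ι g.op := by
  have h₁ : ∀ q, ![ι q] = ι ∘ ![q] := fun q => by funext i; fin_cases i; rfl
  have h₂ : ∀ p q, ![ι p, ι q] = ι ∘ ![p, q] := fun p q => by funext i; fin_cases i <;> rfl
  have h₃ : ∀ o p q, ![ι o, ι p, ι q] = ι ∘ ![o, p, q] := fun o p q => by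
    funext i; fin_cases i <;> rfl
  cases g with
  | had q =>
    simp only [Gate.map, Gate.op]
    rw [onQubits_onQubits (Function.injective_of_subsingleton _) hι, h₁]
  | tee q =>
    simp only [Gate.map, Gate.op]
    rw [onQubits_onQubits (Function.injective_of_subsingleton _) hι, h₁]
  | cnot p q =>
    by_cases h : Function.Injective ![p, q]
    · rw [Gate.map, Gate.op, Gate.op, h₂, if_pos h, if_pos (hι.comp h), onQubits_onQubits h hι]
    · rw [Gate.op_cnot_of_not_injective h, onQubits_one, Gate.map,
        Gate.op_cnot_of_not_injective (by rwa [h₂, hι.of_comp_iff])]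
  | toffoli o p q =>
    by_cases h : Function.Injective ![o, p, q]
    · rw [Gate.map, Gate.op, Gate.op, h₃, if_pos h, if_pos (hι.comp h), onQubits_onQubits h hι]
    · rw [Gate.op_toffoli_of_not_injective h, onQubits_one, Gate.map,
        Gate.op_toffoli_of_not_injective (by rwa [h₃, hι.of_comp_iff])]

/-- This allows `Q_1` to be run on a copy of its registers inside the work register. -/
theorem circuitOp_map {V W : Type} [Fintype V] [DecidableEq V] [Fintype W] [DecidableEq W]
    {ι : V → W} (hι : Function.Injective ι) (gs : List (Gate V)) :
    circuitOp (gs.map (Gate.map ι)) = onQubits ι (circuitOp gs) := by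
  induction gs with
  | nil => simp [circuitOp, onQubits_one]
  | cons g gs ih => rw [List.map_cons, circuitOp, circuitOp, ih, Gate.op_map hι, onQubits_mul hι]

/-! ## The action of gates on kets -/

section Kets

variable {W : Type} [Fintype W] [DecidableEq W]

/-- A permutation matrix pulls amplitudes back along the inverse permutation, which for an
involution is `f` itself. -/
theorem onQubits_mulVec_involution {V : Type} [Fintype V] [DecidableEq V] {ι : V → W}
    (hι : Function.Injective ι) {f : (V → Bool) → V → Bool} (hf : Function.Involutive f) {M : Op V}
    (hM : ∀ x y, M x y = if x = f y then 1 else 0) (ψ : Ket W) (x : W → Bool) :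
    (onQubits ι M *ᵥ ψ) x = ψ (Function.extend ι (f (x ∘ ι)) x) := by
  rw [onQubits_mulVec hι, mulVec, dotProduct, Finset.sum_eq_single (f (x ∘ ι))]
  · simp [hM, hf (x ∘ ι)]
  · intro v _ hv
    rw [hM, if_neg, zero_mul]
    intro h
    exact hv (by rw [h, hf v])
  · simp

theorem had_mulVec (q : W) (ψ : Ket W) (x : W → Bool) :
    ((Gate.had q).op *ᵥ ψ) x = (ψ (Function.update x q false) +
      (if x q then -1 else 1) * ψ (Function.update x q true)) / (Real.sqrt 2 : ℂ) := by
  have hι : Function.Injective ![q] := Function.injective_of_subsingleton _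
  have key : ∀ b : Bool, Function.extend ![q] (fun _ => b) x = Function.update x q b := by
    intro b
    funext w
    by_cases hw : w = q
    · subst hw
      rw [Function.update_self]
      exact hι.extend_apply (fun _ => b) x 0
    · rw [Function.update_of_ne hw, Function.extend_apply']
      rintro ⟨i, hi⟩
      fin_cases i
      exact hw hi.symm
  rw [Gate.op, onQubits_mulVec hι, mulVec, dotProduct,
    ← (Equiv.funUnique (Fin 1) Bool).symm.sum_comp, Fintype.sum_bool]
  have e : ∀ b, (Equiv.funUnique (Fin 1) Bool).symm b = fun _ => b := fun b => rfl
  rw [e, e, key, key]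
  simp only [hadamardMatrix, Function.comp, Matrix.cons_val_zero]
  rcases Bool.eq_false_or_eq_true (x q) with h | h <;> simp only [h] <;> simp <;> ring

theorem cnot_mulVec {p q : W} (h : p ≠ q) (ψ : Ket W) (x : W → Bool) :
    ((Gate.cnot p q).op *ᵥ ψ) x = ψ (Function.update x q (xor (x p) (x q))) := by
  have hι : Function.Injective ![p, q] := by
    intro i j hij
    fin_cases i <;> fin_cases j <;> simp_all [eq_comm]
  rw [Gate.op, if_pos hι,
    onQubits_mulVec_involution hι cnotFun_involutive (M := cnotMatrix) (fun _ _ => rfl)]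
  congr 1
  funext w
  by_cases hw : w = q
  · subst hw
    rw [Function.update_self]
    exact hι.extend_apply (cnotFun (x ∘ ![p, w])) x 1
  · rw [Function.update_of_ne hw]
    by_cases hw' : w = p
    · subst hw'
      exact hι.extend_apply (cnotFun (x ∘ ![w, q])) x 0
    · rw [Function.extend_apply']
      rintro ⟨i, hi⟩
      fin_cases i <;> simp_all

theorem toffoli_mulVec {o p q : W} (h₁ : o ≠ p) (h₂ : o ≠ q) (h₃ : p ≠ q) (ψ : Ket W)
    (x : W → Bool) :
    ((Gate.toffoli o p q).op *ᵥ ψ) x = ψ (Function.update x q (xor (x o && x p) (x q))) := by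
  have hι : Function.Injective ![o, p, q] := by
    intro i j hij
    fin_cases i <;> fin_cases j <;> simp_all [eq_comm]
  rw [Gate.op, if_pos hι,
    onQubits_mulVec_involution hι toffoliFun_involutive (M := toffoliMatrix) (fun _ _ => rfl)]
  congr 1
  funext w
  by_cases hw : w = q
  · subst hw
    rw [Function.update_self]
    exact hι.extend_apply (toffoliFun (x ∘ ![o, p, w])) x 2
  · rw [Function.update_of_ne hw]
    by_cases hp : w = p
    · subst hp
      exact hι.extend_apply (toffoliFun (x ∘ ![o, w, q])) x 1
    · by_cases ho : w = o
      · subst ho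
        exact hι.extend_apply (toffoliFun (x ∘ ![w, p, q])) x 0
      · rw [Function.extend_apply']
        rintro ⟨i, hi⟩
        fin_cases i <;> simp_all

end Kets

end QBC

namespace QBC

open Matrix

/-! ## Product kets -/

/-- The product `v ⊗ w` of two kets. -/
def Ket.prod {V W : Type} (v : Ket V) (w : Ket W) : Ket (V ⊕ W) :=
  fun x => v (x ∘ Sum.inl) * w (x ∘ Sum.inr)

theorem tensor_pureState {V W : Type} (v : Ket V) (w : Ket W) :
    tensor (pureState v) (pureState w) = pureState (v.prod w) := by
  funext x y
  simp only [tensor, pureState, Ket.prod, star_mul', Function.comp_def]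
  ring

theorem mul_pureState_mul {W : Type} [Fintype W] [DecidableEq W] (U : Op W) (ψ : Ket W) :
    U * pureState ψ * Uᴴ = pureState (U *ᵥ ψ) := by
  have : ∀ φ : Ket W, pureState φ = vecMulVec φ (star φ) := fun φ => rfl
  rw [this, this, mul_vecMulVec, vecMulVec_mul, star_mulVec]

/-! ## Controlled exchange of two registers -/

section Exchange

variable {A W : Type} [Fintype A] [DecidableEq A] [Fintype W] [DecidableEq W]

/-- The bits of `x` after the exchange of the qubits `i` and `κ i`, for `i` in `l`. -/
noncomputable def exchangeOn (κ : A → W) (l : List A) (x : A ⊕ W → Bool) : A ⊕ W → Bool :=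
  Sum.elim (fun i => if i ∈ l then x (.inr (κ i)) else x (.inl i))
    (Function.extend κ (fun i => if i ∈ l then x (.inl i) else x (.inr (κ i))) (x ∘ Sum.inr))

/-- The bits of `x` after the exchange of the qubits `i` and `κ i`, for all `i`. -/
noncomputable def exchange (κ : A → W) (x : A ⊕ W → Bool) : A ⊕ W → Bool :=
  Sum.elim (x ∘ Sum.inr ∘ κ) (Function.extend κ (x ∘ Sum.inl) (x ∘ Sum.inr))

/-- The instructions that exchange the qubits `a` and `b` if the qubit `t` is `1`. -/
def cswapGates {X : Type} (t a b : X) : List (Gate X) :=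
  [.cnot b a, .toffoli t a b, .cnot b a]

/-- Three alternating CNOTs swap two qubits. Only the middle one needs the control, since without it
the outer two cancel. -/
theorem cswapGates_mulVec {X : Type} [Fintype X] [DecidableEq X] {t a b : X} (hta : t ≠ a)
    (htb : t ≠ b) (hab : a ≠ b) (ψ : Ket X) (x : X → Bool) :
    (circuitOp (cswapGates t a b) *ᵥ ψ) x = ψ (if x t then x ∘ Equiv.swap a b else x) := by
  simp only [cswapGates, circuitOp, Matrix.one_mul, ← mulVec_mulVec]
  rw [cnot_mulVec hab.symm, toffoli_mulVec hta htb hab, cnot_mulVec hab.symm]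
  congr 1
  funext w
  by_cases hwa : w = a
  · subst hwa
    by_cases ht : x t <;> cases h₁ : x w <;> cases h₂ : x b <;>
      simp [hta, hab, hab.symm, ht, h₁, h₂]
  · by_cases hwb : w = b
    · subst hwb
      by_cases ht : x t <;> cases h₁ : x w <;> cases h₂ : x a <;>
        simp [hta, hab, hab.symm, ht, h₁, h₂]
    · by_cases ht : x t <;>
        simp [Function.update_apply, hwa, hwb, ht, Equiv.swap_apply_of_ne_of_ne]

theorem exchangeOn_comp_swap {κ : A → W} (hκ : Function.Injective κ) {i : A} {l : List A}
    (hi : i ∉ l) (x : A ⊕ W → Bool) :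
    exchangeOn κ l x ∘ Equiv.swap (Sum.inl i) (Sum.inr (κ i)) = exchangeOn κ (i :: l) x := by
  funext w
  rcases w with j | w
  · by_cases hj : j = i
    · subst hj
      simp [exchangeOn, hκ.extend_apply, hi]
    · have : Equiv.swap (Sum.inl i) (Sum.inr (κ i)) (Sum.inl j) = (Sum.inl j : A ⊕ W) :=
        Equiv.swap_apply_of_ne_of_ne (by simpa using hj) (by simp)
      simp [exchangeOn, hj, this]
  · by_cases hw : ∃ j, κ j = w
    · obtain ⟨j, rfl⟩ := hw
      by_cases hj : j = i
      · subst hj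
        simp [exchangeOn, hκ.extend_apply, hi]
      · have : Equiv.swap (Sum.inl i) (Sum.inr (κ i)) (Sum.inr (κ j)) = (Sum.inr (κ j) : A ⊕ W) :=
          Equiv.swap_apply_of_ne_of_ne (by simp) (by simpa using fun h => hj (hκ h))
        simp [exchangeOn, hκ.extend_apply, hj, this]
    · have : Equiv.swap (Sum.inl i) (Sum.inr (κ i)) (Sum.inr w) = (Sum.inr w : A ⊕ W) :=
        Equiv.swap_apply_of_ne_of_ne (by simp) (by simpa using fun h => hw ⟨i, h.symm⟩)
      simp [exchangeOn, Function.extend_apply' _ _ _ hw, this]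

/-- The swaps involve disjoint pairs and leave the control `t` alone, so they compose to a single
controlled exchange. `Nodup` is essential: a repeated pair would be swapped back. -/
theorem cswaps_mulVec {κ : A → W} (hκ : Function.Injective κ) {t : W} (ht : t ∉ Set.range κ)
    {l : List A} (hl : l.Nodup) (ψ : Ket (A ⊕ W)) (x : A ⊕ W → Bool) :
    (circuitOp (l.flatMap fun i => cswapGates (.inr t) (.inl i) (.inr (κ i))) *ᵥ ψ) x =
      ψ (if x (.inr t) then exchangeOn κ l x else x) := by
  induction l generalizing ψ x with
  | nil =>
    have : exchangeOn κ [] x = x := by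
      funext w
      rcases w with j | w
      · simp [exchangeOn]
      · by_cases hw : ∃ j, κ j = w
        · obtain ⟨j, rfl⟩ := hw
          simp [exchangeOn, hκ.extend_apply]
        · simp [exchangeOn, Function.extend_apply' _ _ _ hw]
    simp [circuitOp, this]
  | cons i l ih =>
    obtain ⟨hi, hl⟩ := List.nodup_cons.1 hl
    rw [List.flatMap_cons, circuitOp_append, ← mulVec_mulVec, ih hl,
      cswapGates_mulVec (by simp) (by simpa using fun h => ht ⟨i, h.symm⟩) (by simp),
      ← exchangeOn_comp_swap hκ hi]
    have ht' : ¬ ∃ a, κ a = t := ht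
    have : exchangeOn κ l x (.inr t) = x (.inr t) := by
      simp [exchangeOn, Function.extend_apply' _ _ _ ht']
    by_cases h : x (.inr t) <;> simp [h, this]

theorem exchangeOn_eq_exchange {κ : A → W} {l : List A} (hl : ∀ i, i ∈ l) (x : A ⊕ W → Bool) :
    exchangeOn κ l x = exchange κ x := by
  simp only [exchangeOn, exchange, hl, if_true]
  rfl

theorem exchange_involutive {κ : A → W} (hκ : Function.Injective κ) :
    Function.Involutive (exchange κ) := by
  intro x
  funext w
  rcases w with j | w
  · simp [exchange, hκ.extend_apply]
  · by_cases hw : ∃ j, κ j = w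
    · obtain ⟨j, rfl⟩ := hw
      simp [exchange, hκ.extend_apply]
    · simp [exchange, Function.extend_apply' _ _ _ hw]

end Exchange

/-! ## The attack -/

section Attack

variable {A V W : Type} [Fintype A] [DecidableEq A] [Fintype V] [DecidableEq V] [Fintype W]
  [DecidableEq W]

/-- The circuit that prepares the state of the circuit `gs` on the qubits `ι v` of the work register
`W`, and then exchanges `a` and `ι (e a)`, for `a` in `l`, controlled on the qubit `t` of the work
register, which is prepared in the state `(|0⟩ + |1⟩)/√2` and measured in the Hadamard basis. -/
noncomputable def exchangeTest (t : W) (ι : V → W) (e : A → V) (l : List A) (gs : List (Gate V)) :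
    List (Gate (A ⊕ W)) :=
  .had (.inr t) :: (gs.map (Gate.map (Sum.inr ∘ ι)) ++
    (l.flatMap (fun i => cswapGates (.inr t) (.inl i) (.inr (ι (e i)))) ++ [.had (.inr t)]))

open Classical in
/-- The ket `v ⊗ ψ`, with `ψ` placed on the qubits `ι v` and all other qubits of `W` being `0`. -/
noncomputable def placed (ι : V → W) (v : Ket A) (ψ : Ket V) : Ket (A ⊕ W) :=
  fun x => if ∀ w, w ∉ Set.range ι → (fun _ => false : W → Bool) w = x (.inr w) then
    v (x ∘ Sum.inl) * ψ (x ∘ Sum.inr ∘ ι) else 0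

theorem placed_of_control {t : W} {ι : V → W} (ht : t ∉ Set.range ι) (v : Ket A) (ψ : Ket V)
    {x : A ⊕ W → Bool} (hx : x (.inr t) = true) : placed ι v ψ x = 0 := by
  rw [placed, if_neg]
  intro h
  simpa [hx] using h t ht

theorem onQubits_inr_mulVec_prod {ι : V → W} (hι : Function.Injective ι) (U : Op V) (v : Ket A) :
    onQubits (Sum.inr ∘ ι : V → A ⊕ W) U *ᵥ v.prod (ket0 W) = placed ι v (U *ᵥ ket0 V) := by
  classical
  funext x
  rw [onQubits_mulVec (Sum.inr_injective.comp hι)]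
  have key : ∀ u, v.prod (ket0 W) (Function.extend (Sum.inr ∘ ι) u x) =
      if ∀ w, w ∉ Set.range ι → (fun _ => false : W → Bool) w = x (.inr w) then
        v (x ∘ Sum.inl) * ket0 V u else 0 := by
    intro u
    have h₁ : Function.extend (Sum.inr ∘ ι) u x ∘ Sum.inl = x ∘ Sum.inl := by
      funext a
      exact Function.extend_apply' _ _ _ (by simp)
    have h₂ : Function.extend (Sum.inr ∘ ι) u x ∘ Sum.inr =
        Function.extend ι u (x ∘ Sum.inr) := by
      funext w
      by_cases hw : ∃ j, ι j = w
      · obtain ⟨j, rfl⟩ := hw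
        rw [hι.extend_apply]
        exact (Sum.inr_injective.comp hι).extend_apply u x j
      · rw [Function.extend_apply' _ _ _ hw]
        exact Function.extend_apply' _ _ _ (by simpa using hw)
    rw [Ket.prod, h₁, h₂]
    by_cases h : ∀ w, w ∉ Set.range ι → (fun _ => false : W → Bool) w = x (.inr w)
    · rw [if_pos h]
      congr 1
      simp only [ket0]
      congr 1
      refine propext ⟨fun h' => ?_, fun h' => ?_⟩
      · rw [← extend_comp_self hι u (x ∘ Sum.inr), h']
        rfl
      · subst h'
        funext w
        by_cases hw : ∃ j, ι j = w
        · obtain ⟨j, rfl⟩ := hw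
          rw [hι.extend_apply]
        · rw [Function.extend_apply' _ _ _ hw]
          exact (h w hw).symm
    · rw [if_neg h, ket0, if_neg, mul_zero]
      intro h'
      refine h fun w hw => ?_
      have := congrFun h' w
      rw [Function.extend_apply' _ _ _ (by simpa using hw)] at this
      exact this.symm
  simp only [key, placed]
  split_ifs
  · rw [← smul_eq_mul, ← Pi.smul_apply, ← mulVec_smul]
    rfl
  · exact congrFun (mulVec_zero U) _

theorem had_mulVec_of_control {X : Type} [Fintype X] [DecidableEq X] {q : X} {ψ : Ket X}
    (hψ : ∀ x, x q = true → ψ x = 0) (x : X → Bool) :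
    ((Gate.had q).op *ᵥ ψ) x = ψ (Function.update x q false) / (Real.sqrt 2 : ℂ) := by
  rw [had_mulVec, hψ _ (Function.update_self ..), mul_zero, add_zero]

/-- The hypothesis says that `φ` is `ψ` with the qubit `q` turned from `|0⟩` into `(|0⟩ + |1⟩)/√2`.
An operator that does not touch `q` preserves this relation. -/
theorem onQubits_mulVec_of_control {X : Type} [Fintype X] [DecidableEq X] {q : X} {ι : V → X}
    (hι : Function.Injective ι) (hq : q ∉ Set.range ι) (U : Op V) {ψ φ : Ket X}
    (hφ : ∀ x, φ x = ψ (Function.update x q false) / (Real.sqrt 2 : ℂ)) (x : X → Bool) :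
    (onQubits ι U *ᵥ φ) x = (onQubits ι U *ᵥ ψ) (Function.update x q false) /
      (Real.sqrt 2 : ℂ) := by
  have hq' : ∀ v, ι v ≠ q := fun v h => hq ⟨v, h⟩
  rw [onQubits_mulVec hι, onQubits_mulVec hι]
  have h₁ : Function.update x q false ∘ ι = x ∘ ι := by
    funext v
    simp [hq']
  have h₂ : ∀ v, Function.update (Function.extend ι v x) q false =
      Function.extend ι v (Function.update x q false) := by
    intro v
    funext w
    by_cases hw : ∃ j, ι j = w
    · obtain ⟨j, rfl⟩ := hw
      rw [hι.extend_apply, Function.update_of_ne (hq' j), hι.extend_apply]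
    · rw [Function.extend_apply' _ _ _ hw]
      simp only [Function.update_apply, Function.extend_apply' _ _ _ hw]
  simp only [hφ, h₁, h₂]
  simp only [mulVec, dotProduct, Finset.sum_div, mul_div_assoc]

/-- The usual swap test computation: with `P` the prepared product state, the final amplitudes are
those of `(P + P') / 2` for control `0` and `(P - P') / 2` for control `1`, where `P'` is `P` after
the exchange. The two Hadamard gates contribute a factor `1/√2` each. -/
theorem exchangeTest_mulVec {t : W} {ι : V → W} (hι : Function.Injective ι)
    (ht : t ∉ Set.range ι) {e : A → V} (he : Function.Injective e) {l : List A} (hl : l.Nodup)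
    (hl' : ∀ i, i ∈ l) (gs : List (Gate V)) (v : Ket A) (x : A ⊕ W → Bool) :
    (circuitOp (exchangeTest t ι e l gs) *ᵥ v.prod (ket0 W)) x =
      (placed ι v (circuitOp gs *ᵥ ket0 V) (Function.update x (.inr t) false) +
        (if x (.inr t) then -1 else 1) * placed ι v (circuitOp gs *ᵥ ket0 V)
          (exchange (ι ∘ e) (Function.update x (.inr t) false))) / 2 := by
  have hte : t ∉ Set.range (ι ∘ e) := by
    rintro ⟨i, hi⟩
    exact ht ⟨_, hi⟩
  have htι : (Sum.inr t : A ⊕ W) ∉ Set.range (Sum.inr ∘ ι) := by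
    rintro ⟨i, hi⟩
    exact ht ⟨i, Sum.inr_injective hi⟩
  have h₀ : ∀ x : A ⊕ W → Bool, x (.inr t) = true → v.prod (ket0 W) x = 0 := by
    intro x hx
    rw [Ket.prod, ket0, if_neg, mul_zero]
    intro h
    simpa [hx] using congrFun h t
  have h₂ : (Real.sqrt 2 : ℂ) * (Real.sqrt 2 : ℂ) = 2 := by
    rw [← Complex.ofReal_mul, Real.mul_self_sqrt (by norm_num)]; norm_num
  -- The control is not among the exchanged qubits, so resetting it commutes with the exchange.
  have hex : exchange (ι ∘ e) (Function.update x (.inr t) false) =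
      Function.update (exchange (ι ∘ e) (Function.update x (.inr t) true)) (.inr t) false := by
    funext w
    rcases w with j | w
    · have : ι (e j) ≠ t := fun h => hte ⟨j, h⟩
      simp [exchange, this]
    · by_cases hw : ∃ j, (ι ∘ e) j = w
      · obtain ⟨j, rfl⟩ := hw
        have : (ι ∘ e) j ≠ t := fun h => hte ⟨j, h⟩
        simp only [exchange, Sum.elim_inr, (hι.comp he).extend_apply,
          Function.update_of_ne (Sum.inr_injective.ne this)]
        simp
      · by_cases hwt : w = t
        · subst hwt
          simp [exchange, Function.extend_apply' _ _ _ hw]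
        · simp [exchange, Function.extend_apply' _ _ _ hw, hwt]
  rw [exchangeTest, circuitOp, circuitOp_append, circuitOp_append,
    circuitOp_map (Sum.inr_injective.comp hι)]
  simp only [← mulVec_mulVec, circuitOp, Matrix.one_mul]
  rw [had_mulVec]
  have hc := fun ψ x => cswaps_mulVec (hι.comp he) hte hl ψ x
  simp only [Function.comp_apply] at hc
  rw [hc, hc]
  simp only [exchangeOn_eq_exchange hl', Function.update_self, if_true, Bool.false_eq_true,
    if_false]
  rw [onQubits_mulVec_of_control (Sum.inr_injective.comp hι) htι _ (had_mulVec_of_control h₀),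
    onQubits_mulVec_of_control (Sum.inr_injective.comp hι) htι _ (had_mulVec_of_control h₀),
    onQubits_inr_mulVec_prod hι, hex, Function.update_idem]
  simp only [Function.comp_def]
  rw [← mul_div_assoc, ← add_div, div_div, h₂]

end Attack

end QBC

namespace QBC

open Matrix

/-! ## Sums over the values of qubits -/

section Sums

variable {A V W : Type} [Fintype A] [DecidableEq A] [Fintype V] [DecidableEq V] [Fintype W]
  [DecidableEq W] {E : Type} [AddCommMonoid E]

theorem sum_sumElim (f : (A ⊕ W → Bool) → E) :
    ∑ x, f x = ∑ a : A → Bool, ∑ z : W → Bool, f (Sum.elim a z) := by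
  rw [← (Equiv.sumArrowEquivProdArrow A W Bool).symm.sum_comp, Fintype.sum_prod_type]
  rfl

/-- The flip of the bit `t`. -/
def flipBit (t : W) (x : W → Bool) : W → Bool := Function.update x t (!x t)

theorem flipBit_involutive (t : W) : Function.Involutive (flipBit t) := by
  intro x
  simp [flipBit]

theorem sum_flipBit (t : W) (f : (W → Bool) → E) :
    (∑ x, if x t = true then f x else 0) = ∑ x, if x t = false then f (flipBit t x) else 0 := by
  rw [← Equiv.sum_comp (flipBit_involutive t).toPerm]
  refine Finset.sum_congr rfl fun x _ => ?_
  simp [flipBit]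

theorem sum_eq_sum_flipBit (t : W) (f : (W → Bool) → E) :
    ∑ x, f x = ∑ x, if x t = false then f x + f (flipBit t x) else 0 := by
  have : ∑ x, f x = (∑ x, if x t = false then f x else 0) + ∑ x, if x t = true then f x else 0 := by
    rw [← Finset.sum_add_distrib]
    refine Finset.sum_congr rfl fun x _ => ?_
    cases x t <;> simp
  rw [this, sum_flipBit, ← Finset.sum_add_distrib]
  refine Finset.sum_congr rfl fun x _ => ?_
  cases x t <;> simp

end Sums

theorem sum_normSq_mulVec {W : Type} [Fintype W] [DecidableEq W] {U : Op W} (hU : Uᴴ * U = 1)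
    (ψ : Ket W) : ∑ x, Complex.normSq ((U *ᵥ ψ) x) = ∑ x, Complex.normSq (ψ x) := by
  have key : ∀ φ : Ket W, ((∑ x, Complex.normSq (φ x) : ℝ) : ℂ) = star φ ⬝ᵥ φ := by
    intro φ
    simp [dotProduct, Complex.normSq_eq_conj_mul_self]
  have h : star (U *ᵥ ψ) ⬝ᵥ (U *ᵥ ψ) = star ψ ⬝ᵥ ψ := by
    rw [star_mulVec, ← dotProduct_mulVec, mulVec_mulVec, hU, one_mulVec]
  rw [← key, ← key] at h
  exact_mod_cast h

theorem sum_normSq_ket0 (W : Type) [Fintype W] [DecidableEq W] :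
    ∑ x, Complex.normSq (ket0 W x) = 1 := by
  classical
  rw [Finset.sum_eq_single fun _ => false]
  · simp [ket0]
  · intro x _ hx
    simp [ket0, hx]
  · simp

theorem sum_normSq_circuitOp_mulVec_ket0 {W : Type} [Fintype W] [DecidableEq W]
    (gs : List (Gate W)) : ∑ x, Complex.normSq ((circuitOp gs *ᵥ ket0 W) x) = 1 := by
  rw [sum_normSq_mulVec (circuitOp_isometry gs), sum_normSq_ket0]

theorem normSq_sum_mul_le {α : Type} [Fintype α] (f g : α → ℂ) :
    Complex.normSq (∑ x, f x * g x) ≤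
      (∑ x, Complex.normSq (f x)) * ∑ x, Complex.normSq (g x) := by
  simp only [Complex.normSq_eq_norm_sq]
  refine le_trans ?_ (Finset.sum_mul_sq_le_sq_mul_sq _ _ _)
  gcongr
  refine (norm_sum_le _ _).trans_eq ?_
  simp only [norm_mul]

/-! ## Purity of reduced states -/

section Purity

variable {α β : Type} [Fintype α] [Fintype β]

/-- Equality of the purities of the two marginals. Both expand into the same fourfold sum, with the
roles of the index pairs `(a, a')` and `(b, b')` interchanged. -/
theorem sum_normSq_gram_comm (F : α → β → ℂ) :
    ∑ a, ∑ a', Complex.normSq (∑ b, F a b * star (F a' b)) =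
      ∑ b, ∑ b', Complex.normSq (∑ a, F a b * star (F a b')) := by
  have h : ∀ {γ δ : Type} [Fintype γ] [Fintype δ] (G : γ → δ → ℂ),
      ((∑ a, ∑ a', Complex.normSq (∑ b, G a b * star (G a' b)) : ℝ) : ℂ) =
        ∑ a, ∑ a', ∑ b, ∑ b', G a b * star (G a' b) * (star (G a b') * G a' b') := by
    intro γ δ _ _ G
    push_cast
    simp only [← Complex.mul_conj, map_sum, Finset.sum_mul_sum, map_mul, ← Complex.star_def,
      star_star]
  have h' : (∑ a, ∑ a', ∑ b, ∑ b', F a b * star (F a' b) * (star (F a b') * F a' b')) =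
      ∑ b, ∑ b', ∑ a, ∑ a', F a b * star (F a b') * (star (F a' b) * F a' b') := by
    simp only [← Finset.sum_product']
    refine Finset.sum_bij' (fun p _ => (p.2.2.1, p.2.2.2, p.1, p.2.1))
      (fun p _ => (p.2.2.1, p.2.2.2, p.1, p.2.1)) ?_ ?_ ?_ ?_ ?_
    · simp
    · simp
    · simp
    · simp
    · rintro ⟨a, a', b, b'⟩ _
      ring
  have := (h F).trans (h'.trans (h fun b a => F a b).symm)
  exact_mod_cast this

/-- Purity is at least the sum of squares of the diagonal entries of the reduced state. These sum to
`1`, so Cauchy–Schwarz gives at least one over the dimension. -/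
theorem one_le_card_mul_sum_normSq_gram (F : α → β → ℂ)
    (hF : ∑ a, ∑ b, Complex.normSq (F a b) = 1) :
    1 ≤ Fintype.card α * ∑ a, ∑ a', Complex.normSq (∑ b, F a b * star (F a' b)) := by
  have h₁ : ∀ a, (∑ b, Complex.normSq (F a b)) ^ 2 ≤
      ∑ a', Complex.normSq (∑ b, F a b * star (F a' b)) := by
    intro a
    refine le_trans (le_of_eq ?_) (Finset.single_le_sum (fun a' _ => Complex.normSq_nonneg _)
      (Finset.mem_univ a))
    simp only [Complex.star_def, Complex.mul_conj]
    rw [← Complex.ofReal_sum, Complex.normSq_ofReal, sq]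
  calc (1 : ℝ) = (∑ a, ∑ b, Complex.normSq (F a b)) ^ 2 := by rw [hF, one_pow]
    _ ≤ Fintype.card α * ∑ a, (∑ b, Complex.normSq (F a b)) ^ 2 :=
        sq_sum_le_card_mul_sum_sq
    _ ≤ _ := by gcongr with a; exact h₁ a

end Purity

/-! ## The overlap of the reduced states of two kets -/

section Overlap

variable {A B : Type} [Fintype A] [DecidableEq A] [Fintype B] [DecidableEq B]

/-- The overlap `tr (ρ σ)` of the states `ρ` and `σ` of the first register, if the states of both
registers are `φ` and `ψ`. -/
noncomputable def overlap (φ ψ : Ket (A ⊕ B)) : ℝ :=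
  (∑ a, ∑ a', traceSnd (pureState φ) a a' * traceSnd (pureState ψ) a' a).re

theorem traceSnd_pureState_apply (ψ : Ket (A ⊕ B)) (a a' : A → Bool) :
    traceSnd (pureState ψ) a a' = ∑ b, ψ (Sum.elim a b) * star (ψ (Sum.elim a' b)) := rfl

theorem overlap_self (ψ : Ket (A ⊕ B)) :
    overlap ψ ψ = ∑ a : A → Bool, ∑ a' : A → Bool,
      Complex.normSq (∑ b, ψ (Sum.elim a b) * star (ψ (Sum.elim a' b))) := by
  have : ((∑ a : A → Bool, ∑ a' : A → Bool,
      Complex.normSq (∑ b, ψ (Sum.elim a b) * star (ψ (Sum.elim a' b))) : ℝ) : ℂ) =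
      ∑ a, ∑ a', traceSnd (pureState ψ) a a' * traceSnd (pureState ψ) a' a := by
    push_cast
    refine Finset.sum_congr rfl fun a _ => Finset.sum_congr rfl fun a' _ => ?_
    rw [← Complex.mul_conj, traceSnd_pureState_apply, traceSnd_pureState_apply, map_sum]
    congr 1
    refine Finset.sum_congr rfl fun b _ => ?_
    rw [map_mul, Complex.star_def, Complex.conj_conj, mul_comm]
  rw [overlap, ← this, Complex.ofReal_re]

theorem one_le_two_pow_mul_overlap_self {ψ : Ket (A ⊕ B)} (hψ : ∑ x, Complex.normSq (ψ x) = 1) :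
    1 ≤ 2 ^ Fintype.card A * overlap ψ ψ := by
  rw [sum_sumElim] at hψ
  have := one_le_card_mul_sum_normSq_gram (fun a b => ψ (Sum.elim a b)) hψ
  rw [overlap_self]
  simpa using this

theorem one_le_two_pow_mul_overlap_self' {ψ : Ket (A ⊕ B)}
    (hψ : ∑ x, Complex.normSq (ψ x) = 1) : 1 ≤ 2 ^ Fintype.card B * overlap ψ ψ := by
  rw [sum_sumElim, Finset.sum_comm] at hψ
  have := one_le_card_mul_sum_normSq_gram (fun b a => ψ (Sum.elim a b)) hψ
  rw [overlap_self, sum_normSq_gram_comm fun a b => ψ (Sum.elim a b)]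
  simpa using this

end Overlap

/-! ## The exchange test -/

section Test

variable {A V W : Type} [Fintype A] [DecidableEq A] [Fintype V] [DecidableEq V] [Fintype W]
  [DecidableEq W]

theorem sum_placed {E : Type} [AddCommMonoid E] {ι : V → W} (hι : Function.Injective ι)
    (f : (A ⊕ W → Bool) → E)
    [DecidablePred fun z : W → Bool => ∀ w, w ∉ Set.range ι → (fun _ => false : W → Bool) w = z w] :
    (∑ x : A ⊕ W → Bool,
      if ∀ w, w ∉ Set.range ι → (fun _ => false : W → Bool) w = x (.inr w) then f x else 0) =
      ∑ a : A → Bool, ∑ u : V → Bool, f (Sum.elim a (Function.extend ι u fun _ => false)) := by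
  classical
  rw [sum_sumElim]
  refine Finset.sum_congr rfl fun a _ => ?_
  rw [← sum_agree_off_range hι _ fun z => f (Sum.elim a z)]
  rfl

theorem sumElim_extend_comp {ι : V → W} (hι : Function.Injective ι) (a : A → Bool)
    (u : V → Bool) (z : W → Bool) :
    Sum.elim a (Function.extend ι u z) ∘ Sum.inr ∘ ι = u := by
  funext i
  simp [hι.extend_apply]

theorem exchange_sumElim_comp {ι : V → W} (hι : Function.Injective ι) {e : A → V}
    (he : Function.Injective e) (a : A → Bool) (z : W → Bool) :
    exchange (ι ∘ e) (Sum.elim a z) ∘ Sum.inr ∘ ι = Function.extend e a (z ∘ ι) := by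
  funext v
  by_cases hv : ∃ i, e i = v
  · obtain ⟨i, rfl⟩ := hv
    rw [he.extend_apply]
    exact (hι.comp he).extend_apply _ _ i
  · rw [Function.extend_apply' _ _ _ hv]
    refine Function.extend_apply' _ _ _ ?_
    rintro ⟨i, hi⟩
    exact hv ⟨i, hι hi⟩

open Classical in
theorem placed_exchange {ι : V → W} (hι : Function.Injective ι) {e : A → V}
    (he : Function.Injective e) (v : Ket A) (ψ : Ket V) (a : A → Bool) (z : W → Bool) :
    placed ι v ψ (exchange (ι ∘ e) (Sum.elim a z)) =
      if ∀ w, w ∉ Set.range ι → (fun _ => false : W → Bool) w = z w then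
        v (z ∘ ι ∘ e) * ψ (Function.extend e a (z ∘ ι)) else 0 := by
  have h : ∀ w, w ∉ Set.range ι → exchange (ι ∘ e) (Sum.elim a z) (.inr w) = z w := by
    intro w hw
    refine Function.extend_apply' _ _ _ ?_
    rintro ⟨i, hi⟩
    exact hw ⟨_, hi⟩
  rw [placed, exchange_sumElim_comp hι he]
  congr 1
  refine propext ⟨fun h' w hw => ?_, fun h' w hw => ?_⟩
  · rw [← h w hw, h' w hw]
  · rw [h w hw, h' w hw]

theorem exchange_control {t : W} {κ : A → W} (ht : t ∉ Set.range κ) (x : A ⊕ W → Bool) :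
    exchange κ x (.inr t) = x (.inr t) :=
  Function.extend_apply' _ _ _ ht

/-- The probability of control outcome `1` is `‖P - P'‖² / 4`, with `P'` the exchange of `P`. Both
have squared norm `∑ |v a|²`, so only the cross term depends on the overlap. The ket `v` is not
normalized because it will be one member of an ensemble. -/
theorem sum_normSq_exchangeTest {t : W} {ι : V → W} (hι : Function.Injective ι)
    (ht : t ∉ Set.range ι) {e : A → V} (he : Function.Injective e) {l : List A} (hl : l.Nodup)
    (hl' : ∀ i, i ∈ l) (gs : List (Gate V)) (v : Ket A) :
    (∑ x : A ⊕ W → Bool, if x (.inr t) = true then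
      Complex.normSq ((circuitOp (exchangeTest t ι e l gs) *ᵥ v.prod (ket0 W)) x) else 0) =
    ((∑ a, Complex.normSq (v a)) - (∑ a, ∑ u, v a * (circuitOp gs *ᵥ ket0 V) u *
      star (v (u ∘ e) * (circuitOp gs *ᵥ ket0 V) (Function.extend e a u))).re) / 2 := by
  classical
  have hte : t ∉ Set.range (ι ∘ e) := by
    rintro ⟨i, hi⟩
    exact ht ⟨_, hi⟩
  set ψ := circuitOp gs *ᵥ ket0 V with hψ
  set P := placed ι v ψ with hP
  -- Flipping the control turns the sum over outcome `1` into a sum over all `x`: where the control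
  -- is `1`, both `P` and its exchange vanish.
  have h₁ : (∑ x : A ⊕ W → Bool, if x (.inr t) = true then
      Complex.normSq ((circuitOp (exchangeTest t ι e l gs) *ᵥ v.prod (ket0 W)) x) else 0) =
      ∑ x, Complex.normSq (P x - P (exchange (ι ∘ e) x)) / 4 := by
    rw [sum_flipBit]
    refine Finset.sum_congr rfl fun x _ => ?_
    cases hx : x (.inr t)
    · have h₂ : Function.update (flipBit (.inr t) x) (.inr t) false = x := by
        rw [flipBit, Function.update_idem, ← hx, Function.update_eq_self]
      have h₃ : flipBit (Sum.inr t) x (Sum.inr t) = true := by simp [flipBit, hx]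
      rw [if_pos rfl, exchangeTest_mulVec hι ht he hl hl', h₂, h₃, if_pos rfl, neg_one_mul,
        ← sub_eq_add_neg, Complex.normSq_div]
      congr 1
      norm_num [Complex.normSq_apply]
    · rw [if_neg (by simp), hP, placed_of_control ht v ψ hx, placed_of_control ht v ψ
        (by rw [exchange_control hte, hx])]
      simp
  have h₂ : ∑ x, Complex.normSq (P x) = ∑ a, Complex.normSq (v a) := by
    simp only [hP, placed, apply_ite Complex.normSq, map_zero, Complex.normSq_mul]
    rw [sum_placed hι]
    simp only [sumElim_extend_comp hι, Sum.elim_comp_inl, ← Finset.mul_sum]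
    rw [hψ, sum_normSq_circuitOp_mulVec_ket0]
    simp
  have h₃ : ∑ x, P x * star (P (exchange (ι ∘ e) x)) =
      ∑ a, ∑ u, v a * ψ u * star (v (u ∘ e) * ψ (Function.extend e a u)) := by
    have : ∀ x, P x * star (P (exchange (ι ∘ e) x)) =
        if ∀ w, w ∉ Set.range ι → (fun _ => false : W → Bool) w = x (.inr w) then
          v (x ∘ Sum.inl) * ψ (x ∘ Sum.inr ∘ ι) * star (P (exchange (ι ∘ e) x)) else 0 := by
      intro x
      rw [hP, placed]
      split_ifs <;> simp
    simp only [this]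
    rw [sum_placed hι]
    refine Finset.sum_congr rfl fun a _ => Finset.sum_congr rfl fun u _ => ?_
    have h₄ : Function.extend ι u (fun _ => false) ∘ ι ∘ e = u ∘ e := by
      rw [← Function.comp_assoc, extend_comp_self hι]
    rw [hP, placed_exchange hι he, if_pos, h₄, sumElim_extend_comp hι, extend_comp_self hι, Sum.elim_comp_inl]
    intro w hw
    exact (Function.extend_apply' u (fun _ => false) w hw).symm
  rw [h₁, ← Finset.sum_div]
  simp only [Complex.normSq_sub, Finset.sum_sub_distrib, Finset.sum_add_distrib]
  have h₄ : ∑ x, Complex.normSq (P (exchange (ι ∘ e) x)) = ∑ x, Complex.normSq (P x) :=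
    Equiv.sum_comp (exchange_involutive (hι.comp he)).toPerm fun x => Complex.normSq (P x)
  rw [h₄, h₂,
    ← Finset.mul_sum, ← Complex.re_sum]
  simp only [← Complex.star_def]
  rw [h₃]
  ring

end Test

end QBC

namespace QBC

open Matrix

/-! ### Success probabilities of the exchange test as an attack on hiding and on binding. -/

section Registers

variable {A B W : Type} [Fintype A] [DecidableEq A] [Fintype B] [DecidableEq B] [Fintype W]
  [DecidableEq W]

theorem extend_inl (a : A → Bool) (u : A ⊕ B → Bool) :
    Function.extend Sum.inl a u = Sum.elim a (u ∘ Sum.inr) := by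
  funext w
  rcases w with i | j
  · exact Sum.inl_injective.extend_apply _ _ i
  · exact Function.extend_apply' _ _ _ (by simp)

theorem extend_inr (b : B → Bool) (u : A ⊕ B → Bool) :
    Function.extend Sum.inr b u = Sum.elim (u ∘ Sum.inl) b := by
  funext w
  rcases w with i | j
  · exact Function.extend_apply' _ _ _ (by simp)
  · exact Sum.inr_injective.extend_apply _ _ j

/-- Brings the overlap into the shape of the cross term of the exchange test, summed over the
ensemble indexed by `b`. -/
theorem overlap_eq_sum (φ ψ : Ket (A ⊕ B)) :
    overlap φ ψ = (∑ b : B → Bool, ∑ a : A → Bool, ∑ u : A ⊕ B → Bool,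
      φ (Sum.elim a b) * ψ u * star (φ (Sum.elim (u ∘ Sum.inl) b) *
        ψ (Function.extend Sum.inl a u))).re := by
  rw [overlap]
  congr 1
  symm
  rw [Finset.sum_comm]
  refine Finset.sum_congr rfl fun a _ => ?_
  simp only [sum_sumElim, extend_inl, Sum.elim_comp_inl, Sum.elim_comp_inr]
  rw [Finset.sum_comm]
  refine Finset.sum_congr rfl fun a' _ => ?_
  rw [traceSnd_pureState_apply, traceSnd_pureState_apply, Finset.sum_mul_sum]
  refine Finset.sum_congr rfl fun b _ => Finset.sum_congr rfl fun b' _ => ?_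
  rw [star_mul']
  ring

theorem traceSnd_pureState (φ : Ket (A ⊕ B)) :
    traceSnd (pureState φ) = ∑ b : B → Bool, pureState fun a => φ (Sum.elim a b) := by
  funext a a'
  simp only [traceSnd_pureState_apply, Matrix.sum_apply]
  rfl

theorem tensor_sum {β : Type} [Fintype β] (ρ : β → Op A) (σ : Op W) :
    tensor (∑ b, ρ b) σ = ∑ b, tensor (ρ b) σ := by
  funext x y
  simp only [tensor, Matrix.sum_apply, Finset.sum_mul]

/-- The exchange test on the first register of a state `φ` measures the overlap with the reduced
state that is prepared by the circuit `gs`. -/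
theorem prob_exchangeTest {t : W} {ι : A ⊕ B → W} (hι : Function.Injective ι)
    (ht : t ∉ Set.range ι) {l : List A} (hl : l.Nodup) (hl' : ∀ i, i ∈ l)
    (gs : List (Gate (A ⊕ B))) {φ : Ket (A ⊕ B)} (hφ : ∑ x, Complex.normSq (φ x) = 1)
    {U : Op (A ⊕ W)}
    (hU : U = circuitOp (exchangeTest t ι Sum.inl l gs)) :
    (∑ x : A ⊕ W → Bool, if x (.inr t) = true then
      ((U * tensor (traceSnd (pureState φ)) (pureState (ket0 W)) * Uᴴ) x x).re else 0) =
    (1 - overlap φ (circuitOp gs *ᵥ ket0 (A ⊕ B))) / 2 := by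
  -- The reduced state of `φ` is the sum of the unnormalized pure states `φ(·, b)`, so by linearity
  -- the computation for pure inputs applies to each of them.
  have h₁ : ∀ x, ((U * tensor (traceSnd (pureState φ)) (pureState (ket0 W)) * Uᴴ) x x).re =
      ∑ b : B → Bool, Complex.normSq
        ((U *ᵥ Ket.prod (fun a => φ (Sum.elim a b)) (ket0 W)) x) := by
    intro x
    simp only [traceSnd_pureState, tensor_sum, Matrix.mul_sum, Matrix.sum_mul, tensor_pureState,
      mul_pureState_mul, Matrix.sum_apply, Complex.re_sum]
    refine Finset.sum_congr rfl fun b _ => ?_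
    rw [pureState, Complex.star_def, Complex.mul_conj, Complex.ofReal_re]
  have h₂ : ∀ x : A ⊕ W → Bool, (if x (.inr t) = true then
      ((U * tensor (traceSnd (pureState φ)) (pureState (ket0 W)) * Uᴴ) x x).re else 0) =
      ∑ b : B → Bool, if x (.inr t) = true then Complex.normSq
        ((U *ᵥ Ket.prod (fun a => φ (Sum.elim a b)) (ket0 W)) x) else 0 := by
    intro x
    rw [h₁]
    split_ifs <;> simp
  simp only [h₂]
  rw [Finset.sum_comm]
  simp only [hU, sum_normSq_exchangeTest hι ht Sum.inl_injective hl hl']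
  rw [← Finset.sum_div, Finset.sum_sub_distrib, overlap_eq_sum, Complex.re_sum,
    ← hφ, sum_sumElim fun x => Complex.normSq (φ x), Finset.sum_comm]

theorem mulVec_ket0 (U : Op W) (x : W → Bool) : (U *ᵥ ket0 W) x = U x fun _ => false := by
  classical
  rw [mulVec, dotProduct, Finset.sum_eq_single fun _ => false]
  · simp [ket0]
  · intro y _ hy
    simp [ket0, hy]
  · simp

/-- Acceptance is the projection on `Q|0...0⟩`. As the work register is traced out, the squared
norms of the projections are summed over its basis states `z`. -/
theorem conjTranspose_mul_traceSnd_mul (Q : Op A) (χ : Ket (A ⊕ W)) :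
    ((Qᴴ * traceSnd (pureState χ) * Q) (fun _ => false) (fun _ => false)).re =
      ∑ z : W → Bool, Complex.normSq (∑ x, star ((Q *ᵥ ket0 A) x) * χ (Sum.elim x z)) := by
  have : ((∑ z : W → Bool, Complex.normSq
      (∑ x, star ((Q *ᵥ ket0 A) x) * χ (Sum.elim x z)) : ℝ) : ℂ) =
      (Qᴴ * traceSnd (pureState χ) * Q) (fun _ => false) (fun _ => false) := by
    push_cast
    simp only [← Complex.mul_conj, mul_apply, traceSnd_pureState_apply, conjTranspose_apply,
      mulVec_ket0, Finset.mul_sum, Finset.sum_mul, map_sum, map_mul, ← Complex.star_def,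
      star_star]
    rw [Finset.sum_comm]
    refine Finset.sum_congr rfl fun y _ => ?_
    rw [Finset.sum_comm]
    refine Finset.sum_congr rfl fun x _ => Finset.sum_congr rfl fun z _ => ?_
    ring
  rw [← this, Complex.ofReal_re]

theorem onQubits_map_inr_mulVec_prod (U : Op (B ⊕ W)) (φ : Ket (A ⊕ B)) (w : Ket W)
    (x : A ⊕ B → Bool) (z : W → Bool) :
    (onQubits (Sum.map Sum.inr id : B ⊕ W → (A ⊕ B) ⊕ W) U *ᵥ φ.prod w) (Sum.elim x z) =
      (U *ᵥ Ket.prod (fun b => φ (Sum.elim (x ∘ Sum.inl) b)) w)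
        (Sum.elim (x ∘ Sum.inr) z) := by
  have hι : Function.Injective (Sum.map Sum.inr id : B ⊕ W → (A ⊕ B) ⊕ W) :=
    Sum.map_injective.2 ⟨Sum.inr_injective, Function.injective_id⟩
  rw [onQubits_mulVec hι]
  have h₁ : Sum.elim x z ∘ (Sum.map Sum.inr id : B ⊕ W → (A ⊕ B) ⊕ W) =
      Sum.elim (x ∘ Sum.inr) z := by
    funext i
    rcases i with i | i <;> rfl
  rw [h₁]
  congr 2
  funext v
  have h₂ : Function.extend (Sum.map Sum.inr id : B ⊕ W → (A ⊕ B) ⊕ W) v (Sum.elim x z) ∘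
      Sum.inl = Sum.elim (x ∘ Sum.inl) (v ∘ Sum.inl) := by
    funext i
    rcases i with i | i
    · refine Function.extend_apply' _ _ _ ?_
      rintro ⟨j | j, hj⟩ <;> simp at hj
    · exact hι.extend_apply v _ (Sum.inl i)
  have h₃ : Function.extend (Sum.map Sum.inr id : B ⊕ W → (A ⊕ B) ⊕ W) v (Sum.elim x z) ∘
      Sum.inr = v ∘ Sum.inr := by
    funext i
    exact hι.extend_apply v _ (Sum.inr i)
  rw [Ket.prod, Ket.prod, h₂, h₃]

/-- Opening with a fresh copy of the second register of the state that is prepared by the circuit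
`gs` succeeds at least with a probability quadratic in the overlap. -/
theorem overlap_sq_le_prob {t : W} {ι : A ⊕ B → W} (hι : Function.Injective ι)
    (ht : t ∉ Set.range ι) {l : List B} (hl : l.Nodup) (hl' : ∀ i, i ∈ l)
    (gs : List (Gate (A ⊕ B))) {φ : Ket (A ⊕ B)} (hφ : ∑ x, Complex.normSq (φ x) = 1)
    {U : Op (B ⊕ W)} (hU : U = circuitOp (exchangeTest t ι Sum.inr l gs))
    {U' : Op ((A ⊕ B) ⊕ W)} (hU' : U' = onQubits (Sum.map Sum.inr id) U)
    {Q : Op (A ⊕ B)} (hQ : Q = circuitOp gs) :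
    overlap φ (Q *ᵥ ket0 (A ⊕ B)) ^ 2 / 2 ≤
      ((Qᴴ * traceSnd (U' * tensor (pureState φ) (pureState (ket0 W)) * U'ᴴ) * Q)
        (fun _ => false) (fun _ => false)).re := by
  classical
  have hte : t ∉ Set.range (ι ∘ (Sum.inr : B → A ⊕ B)) := by
    rintro ⟨i, hi⟩
    exact ht ⟨_, hi⟩
  rw [tensor_pureState, mul_pureState_mul, conjTranspose_mul_traceSnd_mul]
  set ψ := Q *ᵥ ket0 (A ⊕ B) with hψ
  set v : (A ⊕ B → Bool) → Ket B := fun x b => φ (Sum.elim (x ∘ Sum.inl) b) with hv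
  -- `G` and `H` are the vectors left on the work register after the projection on `ψ`, without and
  -- with the exchange of the registers.
  set G : (W → Bool) → ℂ := fun z =>
    ∑ x : A ⊕ B → Bool, star (ψ x) * placed ι (v x) ψ (Sum.elim (x ∘ Sum.inr) z) with hG
  set H : (W → Bool) → ℂ := fun z => ∑ x : A ⊕ B → Bool, star (ψ x) *
    placed ι (v x) ψ (exchange (ι ∘ Sum.inr) (Sum.elim (x ∘ Sum.inr) z)) with hH
  have hχ : ∀ z, (∑ x, star (ψ x) * (U' *ᵥ φ.prod (ket0 W)) (Sum.elim x z)) =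
      (G (Function.update z t false) + (if z t then -1 else 1) *
        H (Function.update z t false)) / 2 := by
    intro z
    simp only [hG, hH, Finset.mul_sum, ← Finset.sum_add_distrib, Finset.sum_div]
    refine Finset.sum_congr rfl fun x _ => ?_
    have : Function.update (Sum.elim (x ∘ Sum.inr : B → Bool) z) (Sum.inr t) false =
        Sum.elim (x ∘ Sum.inr) (Function.update z t false) := Sum.update_elim_inr
    rw [hU', onQubits_map_inr_mulVec_prod, hU,
      exchangeTest_mulVec hι ht Sum.inr_injective hl hl', this, Sum.elim_inr, ← hQ, ← hψ]
    ring
  have hHt : ∀ z, z t = true → H z = 0 := by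
    intro z hz
    refine Finset.sum_eq_zero fun x _ => ?_
    rw [placed_of_control ht _ _ (by rw [exchange_control hte]; exact hz), mul_zero]
  -- Pairing the two values of the control gives `(|G + H|² + |G - H|²) / 4 = (|G|² + |H|²) / 2`.
  -- The part without exchange is discarded.
  have h₁ : (∑ z, Complex.normSq (H z)) / 2 ≤
      ∑ z, Complex.normSq (∑ x, star (ψ x) * (U' *ᵥ φ.prod (ket0 W)) (Sum.elim x z)) := by
    rw [sum_eq_sum_flipBit t fun z => Complex.normSq
      (∑ x, star (ψ x) * (U' *ᵥ φ.prod (ket0 W)) (Sum.elim x z)), Finset.sum_div]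
    refine Finset.sum_le_sum fun z _ => ?_
    cases hz : z t
    · have h₂ : Function.update z t false = z := by rw [← hz, Function.update_eq_self]
      have h₃ : Function.update (flipBit t z) t false = z := by
        rw [flipBit, Function.update_idem, h₂]
      have h₄ : flipBit t z t = true := by simp [flipBit, hz]
      rw [if_pos rfl, hχ, hχ, h₂, h₃, h₄, hz]
      simp only [Complex.normSq_apply, Complex.div_re, Complex.div_im]
      norm_num [Complex.normSq_apply]
      nlinarith [sq_nonneg (G z).re, sq_nonneg (G z).im]
    · rw [hHt z hz]
      simp
  refine le_trans ?_ h₁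
  -- After the exchange the work register holds the first register of the copy and the original
  -- second register. The vector left there is `(ρ_ψ ⊗ 1) φ`, where `ρ_ψ` is the reduced state of
  -- `ψ` on the first register.
  have hH' : ∀ z, H z = if ∀ w, w ∉ Set.range ι → (fun _ => false : W → Bool) w = z w then
      ∑ a : A → Bool, traceSnd (pureState ψ) (z ∘ ι ∘ Sum.inl) a *
        φ (Sum.elim a (z ∘ ι ∘ Sum.inr)) else 0 := by
    intro z
    simp only [hH, placed_exchange hι Sum.inr_injective, extend_inr]
    split_ifs
    · simp only [sum_sumElim, traceSnd_pureState_apply, Finset.sum_mul, hv, Sum.elim_comp_inl,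
        Sum.elim_comp_inr]
      refine Finset.sum_congr rfl fun a _ => Finset.sum_congr rfl fun b _ => ?_
      simp only [Function.comp_assoc]
      ring
    · simp
  set B' : (A ⊕ B → Bool) → ℂ := fun u => ∑ a : A → Bool,
    traceSnd (pureState ψ) (u ∘ Sum.inl) a * φ (Sum.elim a (u ∘ Sum.inr)) with hB'
  have h₂ : ∑ z, Complex.normSq (H z) = ∑ u, Complex.normSq (B' u) := by
    simp only [hH', apply_ite Complex.normSq, map_zero]
    rw [sum_agree_off_range hι (fun _ => false) fun z => Complex.normSq (∑ a : A → Bool,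
      traceSnd (pureState ψ) (z ∘ ι ∘ Sum.inl) a * φ (Sum.elim a (z ∘ ι ∘ Sum.inr)))]
    refine Finset.sum_congr rfl fun u _ => ?_
    simp only [← Function.comp_assoc, extend_comp_self hι, hB']
  -- The overlap is the expectation of `ρ_ψ ⊗ 1` in the unit vector `φ`, so Cauchy–Schwarz bounds
  -- its square by the squared norm of `B'`.
  have h₃ : overlap φ ψ = (∑ u, star (φ u) * B' u).re := by
    rw [overlap]
    congr 1
    simp only [sum_sumElim, hB', Sum.elim_comp_inl, Sum.elim_comp_inr, Finset.mul_sum]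
    rw [Finset.sum_comm]
    refine Finset.sum_congr rfl fun a _ => ?_
    rw [Finset.sum_comm]
    refine Finset.sum_congr rfl fun a' _ => ?_
    rw [traceSnd_pureState_apply, Finset.sum_mul]
    refine Finset.sum_congr rfl fun b _ => ?_
    ring
  have h₄ := normSq_sum_mul_le (fun u => star (φ u)) B'
  have h₅ : ∑ u, Complex.normSq (star (φ u)) = 1 := by
    simpa only [Complex.star_def, Complex.normSq_conj] using hφ
  rw [h₅, one_mul, ← h₂] at h₄
  rw [h₃]
  have h₆ : (∑ u, star (φ u) * B' u).re ^ 2 ≤ Complex.normSq (∑ u, star (φ u) * B' u) := by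
    rw [Complex.normSq_apply, sq]
    nlinarith [mul_self_nonneg (∑ u, star (φ u) * B' u).im]
  linarith

end Registers

end QBC

namespace QBC

open Matrix

/-! ## The description of the attack -/

/-- The position in the work register of the copy of a qubit of a commitment whose registers have
`c` and `r` qubits. It is beyond the `2 * c + 2 * r + 1` qubits of the work register if the qubit
does not exist. -/
def place (c r : ℕ) : ℕ ⊕ ℕ → ℕ
  | .inl i => 2 * i + 2 * r + 1
  | .inr j => 2 * j + 2 * c + 2

/-- Qubit `i` of the commitment register (`role = false`) or of the reveal register
(`role = true`). -/
def registerQubit (role : Bool) (i : ℕ) : ℕ ⊕ ℕ := if role then .inr i else .inl i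

/-- The controlled exchanges of the first `k` qubits of the input register with their partners in the
work register. -/
def exchangeGates (role : Bool) (c r : ℕ) : ℕ → List (Gate (ℕ ⊕ ℕ))
  | 0 => []
  | k + 1 => cswapGates (.inr 0) (.inl k) (.inr (place c r (registerQubit role k))) ++
      exchangeGates role c r k

/-- The attack on a commitment scheme: the exchange test of the input, which is the commitment
register (`role = false`) or the reveal register (`role = true`), with that register of a fresh
commitment to `1`. -/
def attackDesc (role : Bool) (d : CommitmentDesc) : AlgDesc where
  work := 2 * d.commit + 2 * d.reveal
  circuit := .had (.inr 0) ::
    ((d.circuit true).map (Gate.map (Sum.inr ∘ place d.commit d.reveal)) ++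
      (exchangeGates role d.commit d.reveal (if role then d.reveal else d.commit) ++
        [.had (.inr 0)]))

section Placement

variable (c r : ℕ)

/-- The embedding of the registers of a commitment in the work register of the attack. -/
def placeFin (v : Fin c ⊕ Fin r) : Fin (2 * c + 2 * r + 1) :=
  ⟨place c r (v.map Fin.val Fin.val), by
    rcases v with ⟨i, hi⟩ | ⟨j, hj⟩ <;> simp only [place, Sum.map_inl, Sum.map_inr] <;> omega⟩

/-- Parity separates the registers: commitment qubits go to odd positions and reveal qubits to
positive even ones. Position `0` stays free for the control. -/
theorem placeFin_injective : Function.Injective (placeFin c r) := by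
  intro u v h
  have h := congrArg Fin.val h
  rcases u with ⟨i, hi⟩ | ⟨j, hj⟩ <;> rcases v with ⟨i', hi'⟩ | ⟨j', hj'⟩ <;>
    simp only [placeFin, place, Sum.map_inl, Sum.map_inr] at h <;>
    simp only [Sum.inl.injEq, Sum.inr.injEq, Fin.mk.injEq, reduceCtorEq] <;> omega

theorem zero_notMem_range_placeFin : 0 ∉ Set.range (placeFin c r) := by
  rintro ⟨v, hv⟩
  have hv := congrArg Fin.val hv
  rcases v with ⟨i, hi⟩ | ⟨j, hj⟩ <;>
    simp [placeFin, place] at hv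

/-- Nonexistent qubits stay nonexistent, so the instructions skipped in `Q_1` are exactly those
skipped in its copy. Simply placing one register after the other would let an invalid name of the
first register denote a qubit of the second. -/
theorem qubitOf_place (m : ℕ) (q : ℕ ⊕ ℕ) :
    qubitOf m (2 * c + 2 * r + 1) (.inr (place c r q)) =
      (qubitOf c r q).map (Sum.inr ∘ placeFin c r) := by
  rcases q with i | j
  · by_cases h : i < c
    · have : 2 * i + 2 * r + 1 < 2 * c + 2 * r + 1 := by omega
      simp [qubitOf, place, h, this, placeFin]
    · have : ¬ place c r (.inl i) < 2 * c + 2 * r + 1 := by simp only [place]; omega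
      rw [qubitOf, qubitOf, dif_neg this, dif_neg h, Option.map_none]
  · by_cases h : j < r
    · have : 2 * j + 2 * c + 2 < 2 * c + 2 * r + 1 := by omega
      simp [qubitOf, place, h, this, placeFin]
    · have : ¬ place c r (.inr j) < 2 * c + 2 * r + 1 := by simp only [place]; omega
      rw [qubitOf, qubitOf, dif_neg this, dif_neg h, Option.map_none]

theorem gateOf_place (m : ℕ) (g : Gate (ℕ ⊕ ℕ)) :
    gateOf m (2 * c + 2 * r + 1) (g.map (Sum.inr ∘ place c r)) =
      (gateOf c r g).map (Gate.map (Sum.inr ∘ placeFin c r)) := by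
  cases g with
  | had q =>
    simp only [Gate.map, gateOf, Function.comp_apply, qubitOf_place]
    cases qubitOf c r q <;> rfl
  | tee q =>
    simp only [Gate.map, gateOf, Function.comp_apply, qubitOf_place]
    cases qubitOf c r q <;> rfl
  | cnot p q =>
    simp only [Gate.map, gateOf, Function.comp_apply, qubitOf_place]
    cases qubitOf c r p <;> cases qubitOf c r q <;> rfl
  | toffoli o p q =>
    simp only [Gate.map, gateOf, Function.comp_apply, qubitOf_place]
    cases qubitOf c r o <;> cases qubitOf c r p <;> cases qubitOf c r q <;> rfl

theorem filterMap_gateOf_place (m : ℕ) (gs : List (Gate (ℕ ⊕ ℕ))) :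
    (gs.map (Gate.map (Sum.inr ∘ place c r))).filterMap (gateOf m (2 * c + 2 * r + 1)) =
      (gs.filterMap (gateOf c r)).map (Gate.map (Sum.inr ∘ placeFin c r)) := by
  rw [List.filterMap_map, List.map_filterMap]
  exact List.filterMap_congr fun g _ => gateOf_place c r m g

theorem qubitOf_zero (m : ℕ) : qubitOf m (2 * c + 2 * r + 1) (.inr 0) = some (.inr 0) := by
  simp [qubitOf]

/-- None of the instructions is skipped. The list `l` counts down from `k - 1` to `0`. -/
theorem filterMap_exchangeGates {role : Bool} {m : ℕ} {e : Fin m → Fin c ⊕ Fin r}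
    (he : ∀ i, (e i).map Fin.val Fin.val = registerQubit role i) {k : ℕ} (hk : k ≤ m) :
    ∃ l : List (Fin m), l.Nodup ∧ (∀ i, i ∈ l ↔ i.val < k) ∧
      (exchangeGates role c r k).filterMap (gateOf m (2 * c + 2 * r + 1)) =
        l.flatMap fun i => cswapGates (.inr 0) (.inl i) (.inr (placeFin c r (e i))) := by
  induction k with
  | zero => exact ⟨[], by simp, by simp, by simp [exchangeGates]⟩
  | succ k ih =>
    obtain ⟨l, h₁, h₂, h₃⟩ := ih (by omega)
    refine ⟨⟨k, hk⟩ :: l, ?_, ?_, ?_⟩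
    · rw [List.nodup_cons, h₂]
      exact ⟨lt_irrefl k, h₁⟩
    · intro i
      rw [List.mem_cons, h₂, Fin.ext_iff, Nat.lt_succ_iff_lt_or_eq, or_comm]
    · rw [exchangeGates, List.filterMap_append, h₃, List.flatMap_cons]
      congr 1
      have ha : qubitOf m (2 * c + 2 * r + 1) (.inl k) = some (.inl ⟨k, hk⟩) := by
        simp only [qubitOf]
        rw [dif_pos (show k < m from hk)]
      have hb : qubitOf m (2 * c + 2 * r + 1) (.inr (place c r (registerQubit role k))) =
          some (.inr (placeFin c r (e ⟨k, hk⟩))) := by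
        have := he ⟨k, hk⟩
        have hlt := (placeFin c r (e ⟨k, hk⟩)).isLt
        simp only [placeFin, this] at hlt
        simp only [qubitOf]
        rw [dif_pos hlt]
        simp only [placeFin, this]
      simp [cswapGates, gateOf, ha, hb, qubitOf_zero]

theorem filterMap_attackDesc {role : Bool} (d : CommitmentDesc) {m : ℕ}
    (hm : m = if role then d.reveal else d.commit) {e : Fin m → Fin d.commit ⊕ Fin d.reveal}
    (he : ∀ i, (e i).map Fin.val Fin.val = registerQubit role i) :
    ∃ l, l.Nodup ∧ (∀ i, i ∈ l) ∧
      (attackDesc role d).circuit.filterMap (gateOf m (2 * d.commit + 2 * d.reveal + 1)) =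
        exchangeTest 0 (placeFin d.commit d.reveal) e l
          ((d.circuit true).filterMap (gateOf d.commit d.reveal)) := by
  obtain ⟨l, h₁, h₂, h₃⟩ := filterMap_exchangeGates _ _ he le_rfl
  refine ⟨l, h₁, fun i => (h₂ i).2 i.isLt, ?_⟩
  rw [attackDesc, exchangeTest, ← h₃, ← filterMap_gateOf_place, ← hm]
  simp [List.filterMap_append, gateOf, qubitOf_zero]

end Placement

/-! ## The attack on a commitment scheme -/

namespace CommitmentScheme

variable (S : CommitmentScheme)

theorem Ψ_normSq (b : Bool) (n : ℕ) : ∑ x, Complex.normSq (S.Ψ b n x) = 1 :=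
  sum_normSq_circuitOp_mulVec_ket0 _

theorem prOne_attack (hS : PolyTime AlgDesc.encode fun n => attackDesc false (S.desc n))
    (b : Bool) (n : ℕ) :
    QPTAlgorithm.prOne ⟨_, hS⟩ n (S.committedState b n) =
      (1 - overlap (S.Ψ b n) (S.Ψ true n)) / 2 := by
  obtain ⟨l, h₁, h₂, h₃⟩ := filterMap_attackDesc (role := false) (S.desc n)
    (m := (S.desc n).commit) rfl (e := Sum.inl) (fun i => by simp [registerQubit])
  exact prob_exchangeTest (placeFin_injective _ _) (zero_notMem_range_placeFin _ _) h₁ h₂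
    ((S.desc n).circuit true |>.filterMap (gateOf (S.desc n).commit (S.desc n).reveal))
    (S.Ψ_normSq b n) (congrArg circuitOp h₃)

theorem overlap_sq_le_prWin (hS : PolyTime AlgDesc.encode fun n => attackDesc true (S.desc n))
    (n : ℕ) : overlap (S.Ψ false n) (S.Ψ true n) ^ 2 / 2 ≤ S.prWin ⟨_, hS⟩ n := by
  obtain ⟨l, h₁, h₂, h₃⟩ := filterMap_attackDesc (role := true) (S.desc n)
    (m := (S.desc n).reveal) rfl (e := Sum.inr) (fun i => by simp [registerQubit])
  exact overlap_sq_le_prob (placeFin_injective _ _) (zero_notMem_range_placeFin _ _) h₁ h₂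
    ((S.desc n).circuit true |>.filterMap (gateOf (S.desc n).commit (S.desc n).reveal))
    (S.Ψ_normSq false n) (congrArg circuitOp h₃) rfl rfl

end CommitmentScheme

/-! ## Asymptotics -/

/-- Since `2 ≤ e`, one has `2 ^ f n ≤ exp (f n)`, and any natural number above the `O`-constant
serves as the exponent `k`. -/
theorem IsLogarithmic.eventually_two_pow_le {f : ℕ → ℕ} (hf : IsLogarithmic f) :
    ∃ k : ℕ, ∀ᶠ n : ℕ in Filter.atTop, (2 : ℝ) ^ f n ≤ (n : ℝ) ^ k := by
  obtain ⟨B, hB⟩ := Asymptotics.IsBigO.bound hf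
  obtain ⟨k, hk⟩ := exists_nat_ge B
  refine ⟨k, ?_⟩
  filter_upwards [hB, Filter.eventually_ge_atTop 1] with n hn hn1
  have hn1' : (1 : ℝ) ≤ n := by exact_mod_cast hn1
  have hlog : 0 ≤ Real.log n := Real.log_nonneg hn1'
  rw [Real.norm_of_nonneg (Nat.cast_nonneg _), Real.norm_of_nonneg hlog] at hn
  calc (2 : ℝ) ^ f n ≤ Real.exp 1 ^ f n := by
        gcongr
        have := Real.add_one_le_exp (1 : ℝ)
        linarith
    _ = Real.exp (f n) := by rw [← Real.exp_nat_mul, mul_one]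
    _ ≤ Real.exp (k * Real.log n) := by
        gcongr
        exact hn.trans (by gcongr)
    _ = (n : ℝ) ^ k := by rw [Real.exp_nat_mul, Real.exp_log (by linarith)]

/-- Here `s` is the purity of `ρ_1`, `t` the overlap, `p` the hiding advantage and `q` the winning
probability. At a suitable `n`, `n ^ k * s ≥ 1`, while `1/8` and `1/32` make both `n ^ k * (s - t)`
and `n ^ k * t` at most `1/4`. -/
theorem not_negligible_of_isLogarithmic {f : ℕ → ℕ} (hf : IsLogarithmic f) {s t p q : ℕ → ℝ}
    (hs : ∀ n, 1 ≤ 2 ^ f n * s n) (hp : ∀ n, |s n - t n| ≤ 2 * p n)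
    (hq : ∀ n, t n ^ 2 / 2 ≤ q n) (hp' : Negligible p) (hq' : Negligible q) : False := by
  obtain ⟨k, hk⟩ := hf.eventually_two_pow_le
  have h₁ := (hp' k).eventually (gt_mem_nhds (show (0 : ℝ) < 1 / 8 by norm_num))
  have h₂ := (hq' (2 * k)).eventually (gt_mem_nhds (show (0 : ℝ) < 1 / 32 by norm_num))
  obtain ⟨n, h₀, h₁, h₂⟩ := (hk.and (h₁.and h₂)).exists
  have hpow : (0 : ℝ) ≤ (n : ℝ) ^ k := by positivity
  have hs0 : 0 ≤ s n := by
    by_contra h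
    have : (2 : ℝ) ^ f n * s n < 0 := mul_neg_of_pos_of_neg (by positivity) (by linarith)
    linarith [hs n]
  have h₃ : 1 ≤ (n : ℝ) ^ k * s n := (hs n).trans (by gcongr)
  have h₄ : (n : ℝ) ^ k * (s n - t n) ≤ 1 / 4 := by
    have := mul_le_mul_of_nonneg_left ((le_abs_self _).trans (hp n)) hpow
    linarith
  have h₅ : ((n : ℝ) ^ k * t n) ^ 2 ≤ 1 / 16 := by
    have := mul_le_mul_of_nonneg_left (hq n) (by positivity : (0 : ℝ) ≤ (n : ℝ) ^ (2 * k))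
    have h₆ : ((n : ℝ) ^ k * t n) ^ 2 = 2 * ((n : ℝ) ^ (2 * k) * (t n ^ 2 / 2)) := by ring
    linarith
  nlinarith

theorem CommitmentScheme.not_binding_and_hiding (S : CommitmentScheme)
    (hS : ∀ role, PolyTime AlgDesc.encode fun n => attackDesc role (S.desc n)) {f : ℕ → ℕ}
    (hf : IsLogarithmic f) (hf' : f = S.commitLength ∨ f = S.revealLength)
    (hb : S.ComputationallyBinding) (hh : S.ComputationallyHiding) : False := by
  have hp := hh ⟨_, hS false⟩
  have hq := hb ⟨_, hS true⟩
  refine not_negligible_of_isLogarithmic hf (s := fun n => overlap (S.Ψ true n) (S.Ψ true n))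
    (t := fun n => overlap (S.Ψ false n) (S.Ψ true n)) ?_ ?_ ?_ hp hq
  · intro n
    rcases hf' with rfl | rfl
    · simpa using one_le_two_pow_mul_overlap_self (S.Ψ_normSq true n)
    · simpa using one_le_two_pow_mul_overlap_self' (S.Ψ_normSq true n)
  · intro n
    rw [S.prOne_attack, S.prOne_attack, ← sub_div, abs_div]
    simp only [sub_sub_sub_cancel_left, Nat.abs_ofNat]
    exact le_of_eq (by ring)
  · intro n
    exact S.overlap_sq_le_prWin _ n

end QBC

namespace QBC

open Turing Turing.TM2

/-! ## Bounded reachability -/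

/-- The configuration `b` is reached from `a` in at most `n` steps. -/
def Within {α : Type} (f : α → Option α) (n : ℕ) (a b : α) : Prop :=
  ∃ k ≤ n, (flip bind f)^[k] (some a) = some b

namespace Within

variable {α : Type} {f : α → Option α} {m n : ℕ} {a b c : α}

theorem refl (f : α → Option α) (a : α) : Within f 0 a a := ⟨0, le_rfl, rfl⟩

theorem trans (h₁ : Within f m a b) (h₂ : Within f n b c) : Within f (m + n) a c := by
  obtain ⟨k, hk, h₁⟩ := h₁
  obtain ⟨l, hl, h₂⟩ := h₂
  exact ⟨l + k, by omega, by rw [Function.iterate_add_apply, h₁, h₂]⟩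

theorem mono (h : Within f m a b) (hmn : m ≤ n) : Within f n a b := by
  obtain ⟨k, hk, h⟩ := h
  exact ⟨k, hk.trans hmn, h⟩

theorem single (h : f a = some b) : Within f 1 a b := ⟨1, le_rfl, h⟩

end Within

theorem iterate_bind_none {α : Type} (f : α → Option α) (n : ℕ) :
    (flip bind f)^[n] none = none := by
  induction n with
  | zero => rfl
  | succ n ih => rw [Function.iterate_succ_apply]; exact ih

theorem iterate_bind_map {α β : Type} {f : α → Option α} {g : β → Option β} (e : α → β)
    (h : ∀ a b, f a = some b → g (e a) = some (e b)) {n : ℕ} {a b : α}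
    (hab : (flip bind f)^[n] (some a) = some b) :
    (flip bind g)^[n] (some (e a)) = some (e b) := by
  induction n generalizing a with
  | zero =>
    obtain rfl : a = b := by simpa using hab
    rfl
  | succ n ih =>
    rw [Function.iterate_succ_apply] at hab ⊢
    change (flip bind f)^[n] (f a) = some b at hab
    change (flip bind g)^[n] (g (e a)) = some (e b)
    cases hfa : f a with
    | none => rw [hfa, iterate_bind_none] at hab; simp at hab
    | some a' =>
      rw [hfa] at hab
      rw [h a a' hfa]
      exact ih hab

/-! ## The number of pushes of a machine -/

/-- An upper bound for the number of symbols that a statement pushes. -/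
def pushes {K : Type} {Γ : K → Type} {Λ σ : Type} : Stmt Γ Λ σ → ℕ
  | .push _ _ q => pushes q + 1
  | .peek _ _ q => pushes q
  | .pop _ _ q => pushes q
  | .load _ q => pushes q
  | .branch _ q₁ q₂ => pushes q₁ + pushes q₂
  | .goto _ => 0
  | .halt => 0

theorem length_stepAux_le {K : Type} [DecidableEq K] {Γ : K → Type} {Λ σ : Type}
    (q : Stmt Γ Λ σ) (v : σ) (S : ∀ k, List (Γ k)) (k : K) :
    ((stepAux q v S).stk k).length ≤ (S k).length + pushes q := by
  induction q generalizing v S with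
  | push k' f q ih =>
    refine (ih _ _).trans ?_
    by_cases h : k = k'
    · subst h
      simp only [Function.update_self, List.length_cons, pushes]
      omega
    · simp only [Function.update_of_ne h, pushes]
      omega
  | peek k' f q ih => exact ih _ _
  | pop k' f q ih =>
    refine (ih _ _).trans ?_
    by_cases h : k = k'
    · subst h
      simp only [Function.update_self, List.length_tail, pushes]
      omega
    · simp only [Function.update_of_ne h, pushes]
      omega
  | load f q ih => exact ih _ _
  | branch f q₁ q₂ ih₁ ih₂ =>
    simp only [stepAux, pushes]
    cases f v
    · exact (ih₂ _ _).trans (by omega)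
    · exact (ih₁ _ _).trans (by omega)
  | goto f => simp [pushes]
  | halt => simp [pushes]

/-- A machine cannot write more than a constant number of symbols per step. Thus the description
written by a polynomial time machine has polynomial length, which bounds the time of the
translation. -/
theorem length_iterate_step_le {K : Type} [DecidableEq K] {Γ : K → Type} {Λ σ : Type}
    {M : Λ → Stmt Γ Λ σ} {D : ℕ} (hD : ∀ l, pushes (M l) ≤ D) {n : ℕ} {c c' : Cfg Γ Λ σ}
    (h : (flip bind (step M))^[n] (some c) = some c') (k : K) :
    (c'.stk k).length ≤ (c.stk k).length + n * D := by
  induction n generalizing c with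
  | zero =>
    obtain rfl : c = c' := by simpa using h
    omega
  | succ n ih =>
    rw [Function.iterate_succ_apply] at h
    change (flip bind (step M))^[n] (step M c) = some c' at h
    obtain ⟨l, v, S⟩ := c
    cases l with
    | none => rw [step, iterate_bind_none] at h; simp at h
    | some l =>
      have h₁ := ih h
      have h₂ := length_stepAux_le (M l) v S k
      have h₃ := hD l
      have : (n + 1) * D = n * D + D := by ring
      simp only at *
      omega

/-! ## The machine that writes down the attack -/

/-- The stacks of the machine: two counters, an auxiliary counter, the reverse of the output, and the
output. -/
inductive Stk : Type
  | cnt (b : Bool)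
  | tmp
  | rev
  | out
  deriving DecidableEq, Fintype

/-- Elementary operations: write a letter to the reverse of the output, increase a counter, write a
letter to the output, write a counter in unary to the reverse of the output, and restore a counter
from the auxiliary counter. -/
inductive Item : Type
  | lit (x : Letter)
  | inc (b : Bool)
  | put (x : Letter)
  | cnt (b : Bool)
  | res (b : Bool)
  deriving DecidableEq, Fintype

/-- The phases of the machine. -/
inductive Mode : Type
  | header (b : Bool)
  | skip
  | main
  | gadget
  | clean
  | flush
  | finish
  deriving DecidableEq, Fintype

/-- The operations that remain to be done before the next decision. -/
abbrev Todo : Type := {l : List Item // l.length ≤ 40}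

instance : Finite Todo := (List.finite_length_le Item 40).to_subtype

noncomputable instance : Fintype Todo := Fintype.ofFinite _

def Todo.nil : Todo := ⟨[], by simp⟩

def Todo.tail {i : Item} {l : List Item} (h : (i :: l).length ≤ 40) : Todo :=
  ⟨l, (Nat.le_succ _).trans h⟩

def Todo.replace {i : Item} {l : List Item} (j : Item) (h : (i :: l).length ≤ 40) : Todo :=
  ⟨j :: l, h⟩

/-- The operations for a letter of the circuit. -/
def letterItems : Letter → List Item
  | .tick => [.lit .tick, .lit .tick]
  -- The index `i` comes before the register name, so `2 * i` ticks are already written. The offset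
  -- `2 * r + 1` (below, `2 * c + 2`) completes the number given by `place`.
  | .fst => [.cnt true, .cnt true, .lit .tick, .lit .snd]
  | .snd => [.cnt false, .cnt false, .lit .tick, .lit .tick, .lit .snd]
  | x => [.lit x]

/-- The operations that write the name of the qubit of the input register. -/
def inputItems (role : Bool) : List Item := [.cnt role, .lit .fst]

/-- The operations that write the name of the corresponding qubit of the work register. -/
def workItems (role : Bool) : List Item :=
  [.cnt role, .cnt role, .cnt !role, .cnt !role, .lit .tick] ++
    (if role then [.lit .tick, .lit .snd] else [.lit .snd])

/-- The operations that write a controlled exchange. -/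
def gadgetItems (role : Bool) : List Item :=
  (.lit .cnot :: (workItems role ++ inputItems role)) ++
    (.lit .toffoli :: .lit .snd :: (inputItems role ++ workItems role)) ++
    (.lit .cnot :: (workItems role ++ inputItems role))

/-- The decision at the end of a phase, depending on the letter that has been read. -/
def next (role : Bool) : Mode → Option Letter → Mode × Todo
  -- Two ticks per qubit of either register add up to the size `2 * c + 2 * r` of the work register.
  | .header b, some .tick => (.header b, ⟨[.inc b, .lit .tick, .lit .tick], by simp⟩)
  | .header false, _ => (.header true, .nil)
  -- The word `had snd` is the Hadamard gate on the control: index `0` is the empty unary word.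
  | .header true, _ => (.skip, ⟨[.lit .sep, .lit .had, .lit .snd], by simp⟩)
  | .skip, some .sep => (.main, .nil)
  | .skip, some _ => (.skip, .nil)
  | .skip, none => (.main, .nil)
  | .main, some x => (.main, ⟨letterItems x, by cases x <;> simp [letterItems]⟩)
  | .main, none => (.gadget, .nil)
  -- The pop has already lowered the counter, which now holds the index of the qubit to exchange.
  -- The other counter keeps its full value, needed for the offset, until the phase `clean`.
  | .gadget, some _ => (.gadget, ⟨gadgetItems role, by cases role <;> decide⟩)
  | .gadget, none => (.clean, ⟨[.lit .had, .lit .snd], by simp⟩)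
  | .clean, some _ => (.clean, .nil)
  | .clean, none => (.flush, .nil)
  | .flush, some x => (.flush, ⟨[.put x], by simp⟩)
  | .flush, none => (.finish, .nil)
  | .finish, _ => (.finish, .nil)

section Machine

variable (M : FinTM2) (o : M.Γ M.k₁ ≃ Letter) (role : Bool)

/-- The alphabets of the stacks. -/
abbrev Alphabet : M.K ⊕ Stk → Type
  | .inl k => M.Γ k
  | .inr _ => Letter

/-- The labels of the machine. -/
abbrev Lbl : Type := M.Λ ⊕ (Mode × Todo)

/-- The internal states of the machine. -/
abbrev Var : Type := M.σ × Option Letter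

/-- A statement of the original machine as a statement of the new one. -/
def liftStmt : Stmt M.Γ M.Λ M.σ → Stmt (Alphabet M) (Lbl M) (Var M)
  | .push k f q => .push (.inl k) (fun s => f s.1) (liftStmt q)
  | .peek k f q => .peek (.inl k) (fun s x => (f s.1 x, s.2)) (liftStmt q)
  | .pop k f q => .pop (.inl k) (fun s x => (f s.1 x, s.2)) (liftStmt q)
  | .load f q => .load (fun s => (f s.1, s.2)) (liftStmt q)
  | .branch f q₁ q₂ => .branch (fun s => f s.1) (liftStmt q₁) (liftStmt q₂)
  | .goto f => .goto fun s => .inl (f s.1)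
  | .halt => .goto fun _ => .inr (.header false, .nil)

/-- Go to a given phase. -/
def jump (m : Mode) (l : Todo) : Stmt (Alphabet M) (Lbl M) (Var M) :=
  .goto fun _ => .inr (m, l)

/-- Decide about the next phase. -/
def decideNext (m : Mode) : Stmt (Alphabet M) (Lbl M) (Var M) :=
  .goto fun s => .inr (next role m s.2)

/-- Pop a letter from one of the additional stacks. -/
def popStk (k : Stk) (q : Stmt (Alphabet M) (Lbl M) (Var M)) :
    Stmt (Alphabet M) (Lbl M) (Var M) :=
  .pop (.inr k) (fun s x => (s.1, x)) q

/-- Pop a letter from the output of the original machine. -/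
def popWord (q : Stmt (Alphabet M) (Lbl M) (Var M)) : Stmt (Alphabet M) (Lbl M) (Var M) :=
  .pop (.inl M.k₁) (fun s x => (s.1, x.map o)) q

/-- Push a letter on one of the additional stacks. -/
def pushStk (k : Stk) (x : Letter) (q : Stmt (Alphabet M) (Lbl M) (Var M)) :
    Stmt (Alphabet M) (Lbl M) (Var M) :=
  .push (.inr k) (fun _ => x) q

/-- The additional statements. -/
def stageStmt (m : Mode) : Todo → Stmt (Alphabet M) (Lbl M) (Var M)
  | ⟨.lit x :: _, h⟩ => pushStk M .rev x (jump M m (.tail h))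
  | ⟨.inc b :: _, h⟩ => pushStk M (.cnt b) .tick (jump M m (.tail h))
  | ⟨.put x :: _, h⟩ => pushStk M .out x (jump M m (.tail h))
  | ⟨.cnt b :: l, h⟩ => popStk M (.cnt b) (.branch (fun s => s.2.isSome)
      (pushStk M .tmp .tick (pushStk M .rev .tick (jump M m ⟨.cnt b :: l, h⟩)))
      (jump M m (.replace (.res b) h)))
  | ⟨.res b :: l, h⟩ => popStk M .tmp (.branch (fun s => s.2.isSome)
      (pushStk M (.cnt b) .tick (jump M m ⟨.res b :: l, h⟩)) (jump M m (.tail h)))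
  | ⟨[], _⟩ => match m with
    | .header b => popWord M o (decideNext M role (.header b))
    | .skip => popWord M o (decideNext M role .skip)
    | .main => popWord M o (decideNext M role .main)
    | .gadget => popStk M (.cnt role) (decideNext M role .gadget)
    | .clean => popStk M (.cnt !role) (decideNext M role .clean)
    | .flush => popStk M .rev (decideNext M role .flush)
    -- A halting configuration must have the initial internal state.
    | .finish => .load (fun _ => (M.initialState, none)) .halt

/-- The program. -/
def prog : Lbl M → Stmt (Alphabet M) (Lbl M) (Var M)
  | .inl l => liftStmt M (M.m l)
  | .inr (m, l) => stageStmt M o role m l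

/-- The machine that runs `M` and then transforms the description of a commitment scheme that `M`
has written down into the description of the attack. -/
noncomputable def attackMachine : FinTM2 :=
  letI := M.kFin
  letI := M.ΛFin
  letI := M.σFin
  letI : Fintype (Alphabet M (.inl M.k₀)) := M.Γk₀Fin
  { K := M.K ⊕ Stk
    k₀ := .inl M.k₀
    k₁ := .inr .out
    Γ := Alphabet M
    Λ := Lbl M
    main := .inl M.main
    σ := Var M
    initialState := (M.initialState, none)
    m := prog M o role }

/-- The contents of all stacks. -/
def stackContents (S : ∀ k, List (M.Γ k)) (T : Stk → List Letter) : ∀ k, List (Alphabet M k)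
  | .inl k => S k
  | .inr k => T k

theorem update_stackContents_inl (S : ∀ k, List (M.Γ k)) (T : Stk → List Letter) (k : M.K)
    (x : List (M.Γ k)) :
    Function.update (stackContents M S T) (.inl k) x = stackContents M (Function.update S k x) T := by
  funext k'
  rcases k' with k' | k'
  · by_cases h : k' = k
    · subst h
      simp only [Function.update_self, stackContents]
    · have : (Sum.inl k' : M.K ⊕ Stk) ≠ .inl k := by simpa using h
      rw [Function.update_of_ne this]
      simp only [stackContents, Function.update_of_ne h]
  · rw [Function.update_of_ne (by simp)]
    rfl

theorem update_stackContents_inr (S : ∀ k, List (M.Γ k)) (T : Stk → List Letter) (k : Stk)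
    (x : List Letter) :
    Function.update (stackContents M S T) (.inr k) x = stackContents M S (Function.update T k x) := by
  funext k'
  rcases k' with k' | k'
  · rw [Function.update_of_ne (by simp)]
    rfl
  · by_cases h : k' = k
    · subst h
      simp only [Function.update_self, stackContents]
    · have : (Sum.inr k' : M.K ⊕ Stk) ≠ .inr k := by simpa using h
      rw [Function.update_of_ne this]
      simp only [stackContents, Function.update_of_ne h]

/-- A configuration of the original machine as a configuration of the new one. -/
def liftCfg (c : Cfg M.Γ M.Λ M.σ) : Cfg (Alphabet M) (Lbl M) (Var M) where
  l := some (match c.l with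
    | some l => .inl l
    | none => .inr (.header false, .nil))
  var := (c.var, none)
  stk := stackContents M c.stk fun _ => []

theorem stepAux_liftStmt (q : Stmt M.Γ M.Λ M.σ) (v : M.σ) (S : ∀ k, List (M.Γ k)) :
    stepAux (liftStmt M q) (v, none) (stackContents M S fun _ => []) = liftCfg M (stepAux q v S) := by
  induction q generalizing v S with
  | push k f q ih =>
    simp only [liftStmt, stepAux]
    rw [update_stackContents_inl]
    exact ih _ _
  | peek k f q ih => exact ih _ _
  | pop k f q ih =>
    simp only [liftStmt, stepAux]
    rw [update_stackContents_inl]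
    exact ih _ _
  | load f q ih => exact ih _ _
  | branch f q₁ q₂ ih₁ ih₂ =>
    simp only [liftStmt, stepAux]
    cases f v
    · exact ih₂ _ _
    · exact ih₁ _ _
  | goto f => rfl
  | halt => rfl

theorem step_liftCfg (c c' : Cfg M.Γ M.Λ M.σ) (h : step M.m c = some c') :
    step (prog M o role) (liftCfg M c) = some (liftCfg M c') := by
  obtain ⟨l, v, S⟩ := c
  cases l with
  | none => simp at h
  | some l =>
    obtain rfl : stepAux (M.m l) v S = c' := by simpa using h
    exact congrArg some (stepAux_liftStmt M (M.m l) v S)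

end Machine

end QBC

namespace QBC

open Turing Turing.TM2

/-! ## Runs of the machine -/

/-- The additional part of a configuration of the machine. -/
structure Conf : Type where
  mode : Mode
  todo : Todo
  word : List Letter
  count : Bool → ℕ
  tmp : ℕ
  rev : List Letter
  out : List Letter

/-- The contents of the additional stacks. -/
def Conf.stk (c : Conf) : Stk → List Letter
  | .cnt b => encodeNat (c.count b)
  | .tmp => encodeNat c.tmp
  | .rev => c.rev
  | .out => c.out

section Runs

variable (M : FinTM2) (o : M.Γ M.k₁ ≃ Letter) (role : Bool)

/-- The contents of the stacks of the original machine when it has written the word `W`. -/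
def wordStk (W : List Letter) : ∀ k, List (M.Γ k) :=
  Function.update (fun _ => []) M.k₁ (W.map o.symm)

/-- The configuration of the machine, with the letter `a` in its internal state. -/
def Conf.toCfg (c : Conf) (a : Option Letter) : Cfg (Alphabet M) (Lbl M) (Var M) where
  l := some (.inr (c.mode, c.todo))
  var := (M.initialState, a)
  stk := stackContents M (wordStk M o c.word) c.stk

/-- The machine moves from `c` to `c'` in at most `k` steps. -/
structure Runs (k : ℕ) (c c' : Conf) : Prop where
  within : ∀ a, ∃ a', Within (step (prog M o role)) k (c.toCfg M o a) (c'.toCfg M o a')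
  length_rev : c'.rev.length ≤ c.rev.length + k

variable {M o role}

theorem Runs.refl (c : Conf) : Runs M o role 0 c c := ⟨fun a => ⟨a, Within.refl _ _⟩, le_rfl⟩

theorem Runs.trans {k l : ℕ} {c c' c'' : Conf} (h₁ : Runs M o role k c c')
    (h₂ : Runs M o role l c' c'') : Runs M o role (k + l) c c'' := by
  refine ⟨fun a => ?_, ?_⟩
  · obtain ⟨a', h₁⟩ := h₁.within a
    obtain ⟨a'', h₂⟩ := h₂.within a'
    exact ⟨a'', h₁.trans h₂⟩
  · have := h₁.length_rev
    have := h₂.length_rev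
    omega

theorem Runs.mono {k l : ℕ} {c c' : Conf} (h : Runs M o role k c c') (hkl : k ≤ l) :
    Runs M o role l c c' :=
  ⟨fun a => let ⟨a', h⟩ := h.within a; ⟨a', h.mono hkl⟩, h.length_rev.trans (by omega)⟩

theorem Runs.of_stepAux {c c' : Conf} (a' : Option Letter → Option Letter)
    (h : ∀ a, stepAux (stageStmt M o role c.mode c.todo) (M.initialState, a)
      (stackContents M (wordStk M o c.word) c.stk) = c'.toCfg M o (a' a))
    (hr : c'.rev.length ≤ c.rev.length + 1 := by simp) :
    Runs M o role 1 c c' :=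
  ⟨fun a => ⟨a' a, Within.single (congrArg some (h a))⟩, hr⟩

variable {m : Mode} {l : List Item} {W rv ou : List Letter} {n : Bool → ℕ} {t k : ℕ}

theorem stk_update_cnt (l : Todo) (b : Bool) (k : ℕ) :
    Function.update (Conf.stk ⟨m, l, W, n, t, rv, ou⟩) (.cnt b) (encodeNat k) =
      Conf.stk ⟨m, l, W, Function.update n b k, t, rv, ou⟩ := by
  funext s
  cases s with
  | cnt b' =>
    by_cases h : b' = b
    · subst h; simp [Conf.stk]
    · simp [Conf.stk, h]
  | tmp | rev | out => simp [Conf.stk]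

theorem stk_update_tmp (l : Todo) (k : ℕ) :
    Function.update (Conf.stk ⟨m, l, W, n, t, rv, ou⟩) .tmp (encodeNat k) =
      Conf.stk ⟨m, l, W, n, k, rv, ou⟩ := by
  funext s
  cases s <;> simp [Conf.stk]

theorem stk_update_rev (l : Todo) (w : List Letter) :
    Function.update (Conf.stk ⟨m, l, W, n, t, rv, ou⟩) .rev w =
      Conf.stk ⟨m, l, W, n, t, w, ou⟩ := by
  funext s
  cases s <;> simp [Conf.stk]

theorem stk_update_out (l : Todo) (w : List Letter) :
    Function.update (Conf.stk ⟨m, l, W, n, t, rv, ou⟩) .out w =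
      Conf.stk ⟨m, l, W, n, t, rv, w⟩ := by
  funext s
  cases s <;> simp [Conf.stk]

theorem encodeNat_succ (n : ℕ) : encodeNat (n + 1) = .tick :: encodeNat n := rfl

theorem update_wordStk (w : List Letter) :
    Function.update (wordStk M o W) M.k₁ (w.map o.symm) = wordStk M o w :=
  Function.update_idem ..

theorem wordStk_self : wordStk M o W M.k₁ = W.map o.symm := Function.update_self ..

theorem runs_lit {x : Letter} (h : (Item.lit x :: l).length ≤ 40) :
    Runs M o role 1 ⟨m, ⟨.lit x :: l, h⟩, W, n, t, rv, ou⟩ ⟨m, .tail h, W, n, t, x :: rv, ou⟩ := by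
  refine Runs.of_stepAux id fun a => ?_
  simp only [stageStmt, pushStk, jump, stepAux, update_stackContents_inr]
  rw [show stackContents M (wordStk M o W) (Conf.stk ⟨m, ⟨.lit x :: l, h⟩, W, n, t, rv, ou⟩)
    (.inr .rev) = rv from rfl, stk_update_rev]
  rfl

theorem runs_put {x : Letter} (h : (Item.put x :: l).length ≤ 40) :
    Runs M o role 1 ⟨m, ⟨.put x :: l, h⟩, W, n, t, rv, ou⟩ ⟨m, .tail h, W, n, t, rv, x :: ou⟩ := by
  refine Runs.of_stepAux id fun a => ?_
  simp only [stageStmt, pushStk, jump, stepAux, update_stackContents_inr]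
  rw [show stackContents M (wordStk M o W) (Conf.stk ⟨m, ⟨.put x :: l, h⟩, W, n, t, rv, ou⟩)
    (.inr .out) = ou from rfl, stk_update_out]
  rfl

theorem runs_inc {b : Bool} (h : (Item.inc b :: l).length ≤ 40) :
    Runs M o role 1 ⟨m, ⟨.inc b :: l, h⟩, W, n, t, rv, ou⟩
      ⟨m, .tail h, W, Function.update n b (n b + 1), t, rv, ou⟩ := by
  refine Runs.of_stepAux id fun a => ?_
  simp only [stageStmt, pushStk, jump, stepAux, update_stackContents_inr]
  rw [show stackContents M (wordStk M o W) (Conf.stk ⟨m, ⟨.inc b :: l, h⟩, W, n, t, rv, ou⟩)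
    (.inr (.cnt b)) = encodeNat (n b) from rfl, ← encodeNat_succ (n b), stk_update_cnt]
  rfl

theorem runs_cnt_succ {b : Bool} (h : (Item.cnt b :: l).length ≤ 40) (hk : n b = k + 1) :
    Runs M o role 1 ⟨m, ⟨.cnt b :: l, h⟩, W, n, t, rv, ou⟩
      ⟨m, ⟨.cnt b :: l, h⟩, W, Function.update n b k, t + 1, .tick :: rv, ou⟩ := by
  refine Runs.of_stepAux (fun _ => some .tick) fun a => ?_
  simp only [stageStmt, popStk, pushStk, jump, stepAux, update_stackContents_inr]
  rw [show stackContents M (wordStk M o W) (Conf.stk ⟨m, ⟨.cnt b :: l, h⟩, W, n, t, rv, ou⟩)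
    (.inr (.cnt b)) = encodeNat (n b) from rfl, hk, encodeNat_succ, List.tail_cons, stk_update_cnt,
    show stackContents M (wordStk M o W)
      (Conf.stk ⟨m, ⟨.cnt b :: l, h⟩, W, Function.update n b k, t, rv, ou⟩)
      (.inr .tmp) = encodeNat t from rfl, ← encodeNat_succ t, stk_update_tmp,
    show stackContents M (wordStk M o W)
      (Conf.stk ⟨m, ⟨.cnt b :: l, h⟩, W, Function.update n b k, t + 1, rv, ou⟩)
      (.inr .rev) = rv from rfl, stk_update_rev]
  rfl

theorem runs_cnt_zero {b : Bool} (h : (Item.cnt b :: l).length ≤ 40) (hk : n b = 0) :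
    Runs M o role 1 ⟨m, ⟨.cnt b :: l, h⟩, W, n, t, rv, ou⟩
      ⟨m, ⟨.res b :: l, h⟩, W, n, t, rv, ou⟩ := by
  refine Runs.of_stepAux (fun _ => none) fun a => ?_
  have e : Function.update n b 0 = n := by rw [← hk, Function.update_eq_self]
  simp only [stageStmt, popStk, pushStk, jump, stepAux, update_stackContents_inr]
  rw [show stackContents M (wordStk M o W) (Conf.stk ⟨m, ⟨.cnt b :: l, h⟩, W, n, t, rv, ou⟩)
    (.inr (.cnt b)) = encodeNat (n b) from rfl, hk,
    show (encodeNat 0).tail = encodeNat 0 from rfl, stk_update_cnt, e]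
  rfl

theorem runs_res_succ {b : Bool} (h : (Item.res b :: l).length ≤ 40) :
    Runs M o role 1 ⟨m, ⟨.res b :: l, h⟩, W, n, t + 1, rv, ou⟩
      ⟨m, ⟨.res b :: l, h⟩, W, Function.update n b (n b + 1), t, rv, ou⟩ := by
  refine Runs.of_stepAux (fun _ => some .tick) fun a => ?_
  simp only [stageStmt, popStk, pushStk, jump, stepAux, update_stackContents_inr]
  rw [show stackContents M (wordStk M o W) (Conf.stk ⟨m, ⟨.res b :: l, h⟩, W, n, t + 1, rv, ou⟩)
    (.inr .tmp) = encodeNat (t + 1) from rfl, encodeNat_succ, List.tail_cons, stk_update_tmp,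
    show stackContents M (wordStk M o W)
      (Conf.stk ⟨m, ⟨.res b :: l, h⟩, W, n, t, rv, ou⟩)
      (.inr (.cnt b)) = encodeNat (n b) from rfl, ← encodeNat_succ (n b), stk_update_cnt]
  rfl

theorem runs_res_zero {b : Bool} (h : (Item.res b :: l).length ≤ 40) :
    Runs M o role 1 ⟨m, ⟨.res b :: l, h⟩, W, n, 0, rv, ou⟩ ⟨m, .tail h, W, n, 0, rv, ou⟩ := by
  refine Runs.of_stepAux (fun _ => none) fun a => ?_
  simp only [stageStmt, popStk, pushStk, jump, stepAux, update_stackContents_inr]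
  rw [show stackContents M (wordStk M o W) (Conf.stk ⟨m, ⟨.res b :: l, h⟩, W, n, 0, rv, ou⟩)
    (.inr .tmp) = encodeNat 0 from rfl, show (encodeNat 0).tail = encodeNat 0 from rfl,
    stk_update_tmp]
  rfl

/-- The phase decides depending on the next letter of the word. -/
theorem runs_read (hm : m = .skip ∨ m = .main ∨ ∃ b, m = .header b) :
    Runs M o role 1 ⟨m, .nil, W, n, t, rv, ou⟩
      ⟨(next role m W.head?).1, (next role m W.head?).2, W.tail, n, t, rv, ou⟩ := by
  refine Runs.of_stepAux (fun _ => W.head?) fun a => ?_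
  have : stageStmt M o role m .nil = popWord M o (decideNext M role m) := by
    rcases hm with rfl | rfl | ⟨b, rfl⟩ <;> rfl
  simp only [this, popWord, decideNext, stepAux, update_stackContents_inl]
  rw [show stackContents M (wordStk M o W) (Conf.stk ⟨m, .nil, W, n, t, rv, ou⟩)
    (.inl M.k₁) = W.map o.symm from wordStk_self, ← List.map_tail, update_wordStk]
  cases W <;> simp <;> rfl

theorem runs_gadget_or_clean {b : Bool}
    (hm : m = .gadget ∧ b = role ∨ m = .clean ∧ b = !role) :
    Runs M o role 1 ⟨m, .nil, W, n, t, rv, ou⟩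
      ⟨(next role m (encodeNat (n b)).head?).1, (next role m (encodeNat (n b)).head?).2, W,
        Function.update n b (n b - 1), t, rv, ou⟩ := by
  refine Runs.of_stepAux (fun _ => (encodeNat (n b)).head?) fun a => ?_
  have : stageStmt M o role m .nil = popStk M (.cnt b) (decideNext M role m) := by
    rcases hm with ⟨rfl, rfl⟩ | ⟨rfl, rfl⟩ <;> rfl
  simp only [this, popStk, decideNext, stepAux, update_stackContents_inr]
  rw [show stackContents M (wordStk M o W) (Conf.stk ⟨m, .nil, W, n, t, rv, ou⟩)
    (.inr (.cnt b)) = encodeNat (n b) from rfl,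
    show (encodeNat (n b)).tail = encodeNat (n b - 1) from List.tail_replicate, stk_update_cnt]
  rfl

theorem runs_flush_step :
    Runs M o role 1 ⟨.flush, .nil, W, n, t, rv, ou⟩
      ⟨(next role .flush rv.head?).1, (next role .flush rv.head?).2, W, n, t, rv.tail, ou⟩ := by
  refine Runs.of_stepAux (fun _ => rv.head?) (fun a => ?_) (by simp; omega)
  have : stageStmt M o role .flush .nil = popStk M .rev (decideNext M role .flush) := rfl
  simp only [this, popStk, decideNext, stepAux, update_stackContents_inr]
  rw [show stackContents M (wordStk M o W) (Conf.stk ⟨.flush, .nil, W, n, t, rv, ou⟩)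
    (.inr .rev) = rv from rfl, stk_update_rev]
  rfl

/-! ## Writing -/

/-- What an operation writes if the counters have the values `n`. -/
def itemWord (n : Bool → ℕ) : Item → List Letter
  | .lit x => [x]
  | .cnt b => encodeNat (n b)
  | _ => []

/-- The operation just writes something. -/
def Item.IsWrite : Item → Prop
  | .lit _ => True
  | .cnt _ => True
  | _ => False

theorem encodeNat_append_tick (k : ℕ) (w : List Letter) :
    encodeNat k ++ .tick :: w = encodeNat (k + 1) ++ w := by
  rw [encodeNat, encodeNat, List.replicate_succ', List.append_assoc]
  rfl

/-- Reading a counter destroys it, so its ticks move to the auxiliary counter while being copied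
(`down`) and are moved back afterwards (`up`). -/
theorem runs_cnt {b : Bool} (h : (Item.cnt b :: l).length ≤ 40) :
    Runs M o role (2 * n b + 2) ⟨m, ⟨.cnt b :: l, h⟩, W, n, 0, rv, ou⟩
      ⟨m, .tail h, W, n, 0, encodeNat (n b) ++ rv, ou⟩ := by
  have down : ∀ (k t : ℕ) (n : Bool → ℕ) (rv : List Letter), n b = k →
      Runs M o role (k + 1) ⟨m, ⟨.cnt b :: l, h⟩, W, n, t, rv, ou⟩
        ⟨m, ⟨.res b :: l, h⟩, W, Function.update n b 0, t + k, encodeNat k ++ rv, ou⟩ := by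
    intro k
    induction k with
    | zero =>
      intro t n rv hk
      have := runs_cnt_zero (M := M) (o := o) (role := role) (m := m) (W := W) (t := t) (rv := rv)
        (ou := ou) h hk
      rw [← hk, Function.update_eq_self, hk]
      exact this
    | succ k ih =>
      intro t n rv hk
      have := ih (t + 1) (Function.update n b k) (.tick :: rv) (Function.update_self ..)
      rw [Function.update_idem, encodeNat_append_tick, add_right_comm, add_assoc] at this
      exact ((runs_cnt_succ h hk).trans this).mono (by omega)
  have up : ∀ (t : ℕ) (n : Bool → ℕ) (rv : List Letter),
      Runs M o role (t + 1) ⟨m, ⟨.res b :: l, h⟩, W, n, t, rv, ou⟩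
        ⟨m, .tail h, W, Function.update n b (n b + t), 0, rv, ou⟩ := by
    intro t
    induction t with
    | zero =>
      intro n rv
      rw [add_zero, Function.update_eq_self]
      exact runs_res_zero h
    | succ t ih =>
      intro n rv
      have := ih (Function.update n b (n b + 1)) rv
      rw [Function.update_idem, Function.update_self, add_assoc, add_comm 1 t] at this
      exact ((runs_res_succ h).trans this).mono (by omega)
  have h₂ := up (0 + n b) (Function.update n b 0) (encodeNat (n b) ++ rv)
  rw [Function.update_self, Function.update_idem, zero_add, zero_add, Function.update_eq_self] at h₂
  have h₁ := down (n b) 0 n rv rfl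
  rw [zero_add] at h₁
  exact (h₁.trans h₂).mono (by omega)

theorem runs_write {N : ℕ} (hN : ∀ b, n b ≤ N) (h : l.length ≤ 40) (hl : ∀ i ∈ l, i.IsWrite) :
    Runs M o role (l.length * (2 * N + 2)) ⟨m, ⟨l, h⟩, W, n, 0, rv, ou⟩
      ⟨m, .nil, W, n, 0, (l.flatMap (itemWord n)).reverse ++ rv, ou⟩ := by
  induction l generalizing rv with
  | nil => exact (Runs.refl _).mono (Nat.zero_le _)
  | cons i l ih =>
    have hl' : ∀ i ∈ l, i.IsWrite := fun i hi => hl i (List.mem_cons_of_mem _ hi)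
    have hi := hl i List.mem_cons_self
    have e : (l.length + 1) * (2 * N + 2) = l.length * (2 * N + 2) + (2 * N + 2) := by ring
    rw [List.flatMap_cons, List.reverse_append, List.append_assoc, List.length_cons, e]
    cases i with
    | lit x => exact ((runs_lit h).trans (ih ((Nat.le_succ _).trans h) hl')).mono (by omega)
    | cnt b =>
      have := hN b
      rw [itemWord, encodeNat, List.reverse_replicate]
      exact ((runs_cnt h).trans (ih ((Nat.le_succ _).trans h) hl')).mono (by omega)
    | inc b => exact hi.elim
    | put x => exact hi.elim
    | res b => exact hi.elim

end Runs

end QBC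

namespace QBC

open Turing Turing.TM2

/-! ### The phases of the translating machine. -/

section Phases

variable {M : FinTM2} {o : M.Γ M.k₁ ≃ Letter} {role : Bool}
variable {W rv ou : List Letter} {n : Bool → ℕ} {N : ℕ}

theorem runs_header (b : Bool) (k : ℕ) (n : Bool → ℕ) (rv : List Letter) :
    Runs M o role (4 * k + 1) ⟨.header b, .nil, encodeNat k ++ .sep :: W, n, 0, rv, ou⟩
      ⟨(next role (.header b) (some .sep)).1, (next role (.header b) (some .sep)).2, W,
        Function.update n b (n b + k), 0, encodeNat (2 * k) ++ rv, ou⟩ := by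
  induction k generalizing n rv with
  | zero =>
    rw [add_zero, Function.update_eq_self]
    exact runs_read (Or.inr (Or.inr ⟨b, rfl⟩))
  | succ k ih =>
    have h₁ : Runs M o role 1 ⟨.header b, .nil, encodeNat (k + 1) ++ .sep :: W, n, 0, rv, ou⟩
        ⟨.header b, ⟨[.inc b, .lit .tick, .lit .tick], by simp⟩, encodeNat k ++ .sep :: W, n, 0, rv,
          ou⟩ := by
      have := runs_read (M := M) (o := o) (role := role) (W := encodeNat (k + 1) ++ .sep :: W)
        (n := n) (t := 0) (rv := rv) (ou := ou) (m := .header b) (Or.inr (Or.inr ⟨b, rfl⟩))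
      cases b <;> exact this
    have h₂ := ih (Function.update n b (n b + 1)) (.tick :: .tick :: rv)
    rw [Function.update_idem, Function.update_self, add_assoc, add_comm 1 k,
      encodeNat_append_tick, encodeNat_append_tick] at h₂
    exact ((((h₁.trans (runs_inc _)).trans (runs_lit _)).trans (runs_lit _)).trans h₂).mono
      (by omega)

/-- The circuit of `Q_0` plays no role in the attack. Its end is recognized by the separator, which
does not occur in encoded circuits. -/
theorem runs_skip (w : List Letter) (hw : Letter.sep ∉ w) :
    Runs M o role (w.length + 1) ⟨.skip, .nil, w ++ .sep :: W, n, 0, rv, ou⟩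
      ⟨.main, .nil, W, n, 0, rv, ou⟩ := by
  induction w with
  | nil => exact runs_read (Or.inl rfl)
  | cons x w ih =>
    have h₁ : Runs M o role 1 ⟨.skip, .nil, x :: w ++ .sep :: W, n, 0, rv, ou⟩
        ⟨.skip, .nil, w ++ .sep :: W, n, 0, rv, ou⟩ := by
      have := runs_read (M := M) (o := o) (role := role) (W := x :: w ++ .sep :: W)
        (n := n) (t := 0) (rv := rv) (ou := ou) (m := .skip) (Or.inl rfl)
      have hx : x ≠ .sep := fun h => hw (h ▸ List.mem_cons_self)
      cases x <;> first | exact this | exact (hx rfl).elim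
    rw [List.length_cons]
    exact (h₁.trans (ih fun h => hw (List.mem_cons_of_mem _ h))).mono (by omega)

theorem letterItems_isWrite (x : Letter) : ∀ i ∈ letterItems x, i.IsWrite := by
  cases x <;> simp [letterItems, Item.IsWrite]

theorem length_letterItems_le (x : Letter) : (letterItems x).length ≤ 5 := by
  cases x <;> simp [letterItems]

theorem runs_main (hN : ∀ b, n b ≤ N) (w : List Letter) (rv : List Letter) :
    Runs M o role (w.length * (1 + 5 * (2 * N + 2)) + 1) ⟨.main, .nil, w, n, 0, rv, ou⟩
      ⟨.gadget, .nil, [], n, 0,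
        (w.flatMap fun x => (letterItems x).flatMap (itemWord n)).reverse ++ rv, ou⟩ := by
  induction w generalizing rv with
  | nil => exact (runs_read (Or.inr (Or.inl rfl))).mono (by omega)
  | cons x w ih =>
    have h₁ : Runs M o role 1 ⟨.main, .nil, x :: w, n, 0, rv, ou⟩
        ⟨.main, ⟨letterItems x, (length_letterItems_le x).trans (by norm_num)⟩, w, n, 0, rv,
          ou⟩ := by
      have := runs_read (M := M) (o := o) (role := role) (W := x :: w)
        (n := n) (t := 0) (rv := rv) (ou := ou) (m := .main) (Or.inr (Or.inl rfl))
      cases x <;> exact this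
    have h₂ := (h₁.trans (runs_write hN _ (letterItems_isWrite x))).trans (ih _)
    rw [List.flatMap_cons, List.reverse_append, List.append_assoc, List.length_cons]
    refine h₂.mono ?_
    have := Nat.mul_le_mul_right (2 * N + 2) (length_letterItems_le x)
    have e : (w.length + 1) * (1 + 5 * (2 * N + 2)) =
      w.length * (1 + 5 * (2 * N + 2)) + (1 + 5 * (2 * N + 2)) := by ring
    omega

theorem gadgetItems_isWrite (role : Bool) : ∀ i ∈ gadgetItems role, i.IsWrite := by
  cases role <;> simp [gadgetItems, workItems, inputItems, Item.IsWrite]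

theorem length_gadgetItems_le (role : Bool) : (gadgetItems role).length ≤ 31 := by
  cases role <;> decide

theorem encodeNat_append (k l : ℕ) (w : List Letter) :
    encodeNat k ++ (encodeNat l ++ w) = encodeNat (k + l) ++ w := by
  rw [← List.append_assoc, encodeNat, encodeNat, encodeNat, List.replicate_append_replicate]

/-- Both counters are written twice; together with the one or two extra ticks this is the unary form
of `place`. -/
theorem flatMap_gadgetItems {c r : ℕ} (hn : n (!role) = if role then c else r) :
    (gadgetItems role).flatMap (itemWord n) = encodeCircuit (cswapGates (.inr 0) (.inl (n role))
      (.inr (place c r (registerQubit role (n role))))) := by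
  have e : ∀ (k : ℕ) (w : List Letter), encodeNat k ++ .tick :: w = encodeNat (k + 1) ++ w :=
    encodeNat_append_tick
  cases role
  · have h₁ : n false + (n false + (n true + (n true + 1))) = 2 * n false + 2 * r + 1 := by
      simp only [Bool.not_false, Bool.false_eq_true, if_false] at hn
      omega
    have h₂ : encodeNat 0 = [] := rfl
    simp [gadgetItems, workItems, inputItems, itemWord, encodeCircuit, cswapGates, encodeGate,
      encodeQubit, place, registerQubit, e, encodeNat_append, h₁, h₂]
  · have h₁ : n true + (n true + (n false + (n false + 1 + 1))) = 2 * n true + 2 * c + 2 := by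
      simp only [Bool.not_true, if_true] at hn
      omega
    have h₂ : encodeNat 0 = [] := rfl
    simp [gadgetItems, workItems, inputItems, itemWord, encodeCircuit, cswapGates, encodeGate,
      encodeQubit, place, registerQubit, e, encodeNat_append, h₁, h₂]

theorem encodeCircuit_append (gs hs : List (Gate (ℕ ⊕ ℕ))) :
    encodeCircuit (gs ++ hs) = encodeCircuit gs ++ encodeCircuit hs :=
  List.flatMap_append

/-- The counter of the attacked register is both the loop variable and the current index, which is
why `exchangeGates` counts downwards. -/
theorem runs_gadget {c r k : ℕ} (hN : ∀ b, n b ≤ N) (hk : n role = k)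
    (hn : n (!role) = if role then c else r) (rv : List Letter) :
    Runs M o role (k * (1 + 31 * (2 * N + 2)) + 1) ⟨.gadget, .nil, W, n, 0, rv, ou⟩
      ⟨.clean, ⟨[.lit .had, .lit .snd], by simp⟩, W, Function.update n role 0, 0,
        (encodeCircuit (exchangeGates role c r k)).reverse ++ rv, ou⟩ := by
  have hne : (!role) ≠ role := by cases role <;> simp
  induction k generalizing n rv with
  | zero =>
    have := runs_gadget_or_clean (M := M) (o := o) (role := role) (W := W)
      (n := n) (t := 0) (rv := rv) (ou := ou) (m := .gadget) (Or.inl ⟨rfl, rfl⟩)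
    rw [hk] at this
    exact this.mono (by omega)
  | succ k ih =>
    have h₁ : Runs M o role 1 ⟨.gadget, .nil, W, n, 0, rv, ou⟩
        ⟨.gadget, ⟨gadgetItems role, (length_gadgetItems_le role).trans (by norm_num)⟩, W,
          Function.update n role k, 0, rv, ou⟩ := by
      have := runs_gadget_or_clean (M := M) (o := o) (role := role) (W := W)
        (n := n) (t := 0) (rv := rv) (ou := ou) (m := .gadget) (Or.inl ⟨rfl, rfl⟩)
      rw [hk] at this
      exact this
    have hN' : ∀ b, Function.update n role k b ≤ N := by
      intro b
      by_cases h : b = role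
      · subst h
        rw [Function.update_self]
        have := hN b
        omega
      · rw [Function.update_of_ne h]
        exact hN b
    have hn' : Function.update n role k (!role) = if role then c else r := by
      rw [Function.update_of_ne hne, hn]
    have h₂ := (h₁.trans (runs_write hN' _ (gadgetItems_isWrite role))).trans
      (ih hN' (Function.update_self ..) hn' _)
    rw [flatMap_gadgetItems hn', Function.update_self, Function.update_idem, ← List.append_assoc,
      ← List.reverse_append, ← encodeCircuit_append] at h₂
    refine h₂.mono ?_
    have := Nat.mul_le_mul_right (2 * N + 2) (length_gadgetItems_le role)
    have e : (k + 1) * (1 + 31 * (2 * N + 2)) =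
      k * (1 + 31 * (2 * N + 2)) + (1 + 31 * (2 * N + 2)) := by ring
    omega

/-- At the end every stack except the output must be empty. -/
theorem runs_clean {k : ℕ} (hk : n (!role) = k) :
    Runs M o role (k + 1) ⟨.clean, .nil, W, n, 0, rv, ou⟩
      ⟨.flush, .nil, W, Function.update n (!role) 0, 0, rv, ou⟩ := by
  induction k generalizing n with
  | zero =>
    have := runs_gadget_or_clean (M := M) (o := o) (role := role) (W := W)
      (n := n) (t := 0) (rv := rv) (ou := ou) (m := .clean) (Or.inr ⟨rfl, rfl⟩)
    rw [hk] at this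
    exact this
  | succ k ih =>
    have h₁ := runs_gadget_or_clean (M := M) (o := o) (role := role) (W := W)
      (n := n) (t := 0) (rv := rv) (ou := ou) (m := .clean) (Or.inr ⟨rfl, rfl⟩)
    rw [hk] at h₁
    have h₂ := ih (n := Function.update n (!role) k) (Function.update_self ..)
    rw [Function.update_idem] at h₂
    exact (Runs.trans h₁ h₂).mono (by omega)

theorem runs_flush (rv ou : List Letter) :
    Runs M o role (2 * rv.length + 1) ⟨.flush, .nil, W, n, 0, rv, ou⟩
      ⟨.finish, .nil, W, n, 0, [], rv.reverse ++ ou⟩ := by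
  induction rv generalizing ou with
  | nil => exact runs_flush_step
  | cons x rv ih =>
    have h₁ : Runs M o role 1 ⟨.flush, .nil, W, n, 0, x :: rv, ou⟩
        ⟨.flush, ⟨[.put x], by simp⟩, W, n, 0, rv, ou⟩ := runs_flush_step
    rw [List.reverse_cons, List.append_assoc, List.length_cons]
    exact ((h₁.trans (runs_put _)).trans (ih (x :: ou))).mono (by omega)

end Phases

/-! ## The output of the machine -/

theorem sep_notMem_encodeCircuit (gs : List (Gate (ℕ ⊕ ℕ))) : Letter.sep ∉ encodeCircuit gs := by
  have hq : ∀ q, Letter.sep ∉ encodeQubit q := by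
    intro q
    rcases q with i | i <;> simp [encodeQubit, encodeNat]
  simp only [encodeCircuit, List.mem_flatMap, not_exists, not_and]
  intro g _
  cases g <;> simp [encodeGate, hq]

/-- The renaming `place` is affine in the index with slope `2` and an offset depending only on the
register. In unary notation it is therefore a substitution of letters. -/
theorem flatMap_letterItems_encodeCircuit {n : Bool → ℕ} {c r : ℕ} (hc : n false = c)
    (hr : n true = r) (gs : List (Gate (ℕ ⊕ ℕ))) :
    ((encodeCircuit gs).flatMap fun x => (letterItems x).flatMap (itemWord n)) =
      encodeCircuit (gs.map (Gate.map (Sum.inr ∘ place c r))) := by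
  have hnat : ∀ i, ((encodeNat i).flatMap fun x => (letterItems x).flatMap (itemWord n)) =
      encodeNat (2 * i) := by
    intro i
    induction i with
    | zero => rfl
    | succ i ih =>
      rw [encodeNat_succ, List.flatMap_cons, ih]
      rfl
  have e : ∀ (k : ℕ) (w : List Letter), encodeNat k ++ .tick :: w = encodeNat (k + 1) ++ w :=
    encodeNat_append_tick
  have hf : (letterItems .fst).flatMap (itemWord n) =
      encodeNat r ++ (encodeNat r ++ [.tick, .snd]) := by rw [← hr]; rfl
  have hs : (letterItems .snd).flatMap (itemWord n) =
      encodeNat c ++ (encodeNat c ++ [.tick, .tick, .snd]) := by rw [← hc]; rfl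
  have hq : ∀ q, ((encodeQubit q).flatMap fun x => (letterItems x).flatMap (itemWord n)) =
      encodeQubit (.inr (place c r q)) := by
    intro q
    rcases q with i | i
    · have h : 2 * i + (r + (r + 1)) = 2 * i + 2 * r + 1 := by omega
      simp [encodeQubit, hnat, hf, e, encodeNat_append, place, h]
    · have h : 2 * i + (c + (c + 1 + 1)) = 2 * i + 2 * c + 2 := by omega
      simp [encodeQubit, hnat, hs, e, encodeNat_append, place, h]
  rw [encodeCircuit, List.flatMap_assoc, encodeCircuit, List.flatMap_map]
  refine List.flatMap_congr fun g _ => ?_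
  cases g <;>
    simp only [encodeGate, Gate.map, List.flatMap_cons, List.flatMap_append, hq] <;> rfl

theorem runs_attack {M : FinTM2} {o : M.Γ M.k₁ ≃ Letter} {role : Bool} (d : CommitmentDesc) :
    ∃ rv : List Letter, rv.reverse = (attackDesc role d).encode ∧
      Runs M o role (100 * (d.encode.length + 1) ^ 2)
        ⟨.header false, .nil, d.encode, fun _ => 0, 0, [], []⟩
        ⟨.flush, .nil, [], fun _ => 0, 0, rv, []⟩ := by
  obtain ⟨c, r, circ⟩ := d
  set L := (CommitmentDesc.encode ⟨c, r, circ⟩).length with hL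
  have hW : CommitmentDesc.encode ⟨c, r, circ⟩ = encodeNat c ++ .sep :: (encodeNat r ++ .sep ::
      (encodeCircuit (circ false) ++ .sep :: encodeCircuit (circ true))) := by
    simp [CommitmentDesc.encode]
  have hlen : c + r + (encodeCircuit (circ false)).length + (encodeCircuit (circ true)).length + 3 =
      L := by
    rw [hL, hW]
    simp [encodeNat]
    omega
  set n : Bool → ℕ := fun b => if b then r else c with hn
  have hcount : Function.update (Function.update (fun _ => 0) false (0 + c)) true
      ((Function.update (fun _ => 0) false (0 + c) : Bool → ℕ) true + r) = n := by
    funext b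
    cases b <;> simp [hn]
  have hcount' : Function.update (Function.update n role 0) (!role) 0 = fun _ => 0 := by
    funext b
    cases b <;> cases role <;> simp
  have hnL : ∀ b, n b ≤ L := by
    intro b
    cases b <;> simp only [hn, if_true, Bool.false_eq_true, if_false] <;> omega
  have hne : (!role) ≠ role := by cases role <;> simp
  have hnr : n (!role) = if role then c else r := by cases role <;> rfl
  have h₁ := runs_header (M := M) (o := o) (role := role) (W := encodeNat r ++ .sep ::
    (encodeCircuit (circ false) ++ .sep :: encodeCircuit (circ true))) (ou := []) false c
    (fun _ => 0) []
  have h₂ := runs_header (M := M) (o := o) (role := role) (W :=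
    encodeCircuit (circ false) ++ .sep :: encodeCircuit (circ true)) (ou := []) true r
    (Function.update (fun _ => 0) false (0 + c)) (encodeNat (2 * c) ++ [])
  rw [hcount] at h₂
  have h₃ := runs_write (M := M) (o := o) (role := role) (m := .skip)
    (l := [.lit .sep, .lit .had, .lit .snd]) (W :=
    encodeCircuit (circ false) ++ .sep :: encodeCircuit (circ true)) (ou := [])
    (rv := encodeNat (2 * r) ++ (encodeNat (2 * c) ++ [])) hnL (by simp) (by simp [Item.IsWrite])
  have h₄ := (((h₁.trans h₂).trans h₃).trans
    (runs_skip _ (sep_notMem_encodeCircuit (circ false)))).trans (runs_main hnL _ _)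
  rw [flatMap_letterItems_encodeCircuit (c := c) (r := r) rfl rfl] at h₄
  have h₅ := h₄.trans (runs_gadget (c := c) (r := r) hnL rfl hnr _)
  have hnL' : ∀ b, Function.update n role 0 b ≤ L := by
    intro b
    by_cases h : b = role
    · subst h; simp
    · rw [Function.update_of_ne h]; exact hnL b
  have h₆ := (h₅.trans (runs_write hnL' _ (by simp [Item.IsWrite]))).trans
    (runs_clean (Function.update_of_ne hne _ _))
  rw [hcount', ← hW] at h₆
  refine ⟨_, ?_, h₆.mono ?_⟩
  · have hrole : n role = if role then r else c := by cases role <;> rfl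
    rw [hrole]
    have e₁ : ∀ k, (encodeNat k).reverse = encodeNat k := fun k => List.reverse_replicate
    have e₂ : encodeNat (2 * c) ++ encodeNat (2 * r) = encodeNat (2 * c + 2 * r) :=
      List.replicate_append_replicate
    simp only [List.reverse_append, List.reverse_reverse, e₁, attackDesc, AlgDesc.encode,
      List.append_nil, ← e₂]
    simp [encodeCircuit, itemWord, encodeGate, encodeQubit, encodeNat]
  · have hrole := hnL role
    have hrole' := hnL (!role)
    simp only [List.length_cons, List.length_nil]
    nlinarith
end QBC

namespace QBC

open Turing Turing.TM2

/-! ## Initial and final configurations -/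

section Configurations

variable (N : FinTM2)

theorem initList_stk_self (s : List (N.Γ N.k₀)) : (initList N s).stk N.k₀ = s :=
  by simp [initList]

theorem initList_stk_of_ne (s : List (N.Γ N.k₀)) {k : N.K} (h : k ≠ N.k₀) :
    (initList N s).stk k = [] := dif_neg h

theorem haltList_stk_self (s : List (N.Γ N.k₁)) : (haltList N s).stk N.k₁ = s :=
  by simp [haltList]

theorem haltList_stk_of_ne (s : List (N.Γ N.k₁)) {k : N.K} (h : k ≠ N.k₁) :
    (haltList N s).stk k = [] := dif_neg h

theorem length_initList_stk_le (s : List (N.Γ N.k₀)) (k : N.K) :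
    ((initList N s).stk k).length ≤ s.length := by
  by_cases h : k = N.k₀
  · subst h
    rw [initList_stk_self]
  · rw [initList_stk_of_ne N s h]
    exact Nat.zero_le _

end Configurations

/-! ### Correctness and running time of the machine. -/

section Correctness

variable (M : FinTM2) (o : M.Γ M.k₁ ≃ Letter) (role : Bool)

theorem initList_attackMachine (s : List (M.Γ M.k₀)) :
    initList (attackMachine M o role) s = liftCfg M (initList M s) := by
  have : (initList (attackMachine M o role) s).stk = (liftCfg M (initList M s)).stk := by
    funext k
    rcases k with k | k
    · by_cases h : k = M.k₀
      · subst h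
        exact (initList_stk_self (attackMachine M o role) s).trans (initList_stk_self M s).symm
      · have h' : (Sum.inl k : M.K ⊕ Stk) ≠ .inl M.k₀ := by simpa using h
        exact (initList_stk_of_ne (attackMachine M o role) s h').trans
          (initList_stk_of_ne M s h).symm
    · have h' : (Sum.inr k : M.K ⊕ Stk) ≠ .inl M.k₀ := by simp
      exact initList_stk_of_ne (attackMachine M o role) s h'
  exact congrArg (fun S => (⟨some (.inl M.main), (M.initialState, none), S⟩ :
    Cfg (Alphabet M) (Lbl M) (Var M))) this

theorem haltList_stk (W : List Letter) :
    (haltList M (W.map o.symm)).stk = wordStk M o W := by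
  funext k
  by_cases h : k = M.k₁
  · subst h
    exact (haltList_stk_self M _).trans wordStk_self.symm
  · exact (haltList_stk_of_ne M _ h).trans 
      (Function.update_of_ne h (W.map o.symm) fun _ => []).symm

theorem liftCfg_haltList (W : List Letter) :
    liftCfg M (haltList M (W.map o.symm)) =
      Conf.toCfg M o ⟨.header false, .nil, W, fun _ => 0, 0, [], []⟩ none := by
  have : (fun _ => [] : Stk → List Letter) =
      Conf.stk ⟨.header false, .nil, W, fun _ => 0, 0, [], []⟩ := by
    funext k
    cases k <;> rfl
  simp only [liftCfg, Conf.toCfg, haltList_stk, this]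
  rfl

theorem haltList_attackMachine (w : List Letter) :
    (⟨none, (M.initialState, none), stackContents M (wordStk M o [])
      (Conf.stk ⟨.finish, .nil, [], fun _ => 0, 0, [], w⟩)⟩ : Cfg (Alphabet M) (Lbl M) (Var M)) =
      haltList (attackMachine M o role) w := by
  have : stackContents M (wordStk M o []) (Conf.stk ⟨.finish, .nil, [], fun _ => 0, 0, [], w⟩) =
      (haltList (attackMachine M o role) w).stk := by
    funext k
    rcases k with k | k
    · have h' : (Sum.inl k : M.K ⊕ Stk) ≠ .inr .out := by simp
      refine Eq.trans ?_ (haltList_stk_of_ne (attackMachine M o role) w h').symm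
      exact congrFun (Function.update_eq_self M.k₁ fun _ => []) k
    · by_cases h : k = .out
      · subst h
        exact (haltList_stk_self (attackMachine M o role) w).symm
      · have h' : (Sum.inr k : M.K ⊕ Stk) ≠ .inr .out := by simpa using h
        refine Eq.trans ?_ (haltList_stk_of_ne (attackMachine M o role) w h').symm
        cases k <;> first | rfl | exact (h rfl).elim
  exact congrArg (fun S => (⟨none, (M.initialState, none), S⟩ :
    Cfg (Alphabet M) (Lbl M) (Var M))) this

/-- The new machine transforms the output of the original machine. -/
theorem within_attackMachine {s : List (M.Γ M.k₀)} {d : CommitmentDesc} {k : ℕ}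
    (h : (flip bind M.step)^[k] (some (initList M s)) =
      some (haltList M (d.encode.map o.symm))) :
    Within (attackMachine M o role).step (k + 400 * (d.encode.length + 1) ^ 2)
      (initList (attackMachine M o role) s)
      (haltList (attackMachine M o role) (attackDesc role d).encode) := by
  have h₁ : Within (step (prog M o role)) k (initList (attackMachine M o role) s)
      (Conf.toCfg M o ⟨.header false, .nil, d.encode, fun _ => 0, 0, [], []⟩ none) := by
    rw [initList_attackMachine, ← liftCfg_haltList]
    exact ⟨k, le_rfl, iterate_bind_map (liftCfg M) (step_liftCfg M o role) h⟩
  obtain ⟨rv, hrv, h₂⟩ := runs_attack (M := M) (o := o) (role := role) d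
  -- Each step lengthens the reversed output by at most one letter, so the step bound also controls
  -- the cost of the final reversal.
  have hlen := h₂.length_rev
  obtain ⟨a, h₃⟩ := (h₂.trans (runs_flush rv [])).within none
  rw [hrv, List.append_nil] at h₃
  have h₄ : step (prog M o role)
      (Conf.toCfg M o ⟨.finish, .nil, [], fun _ => 0, 0, [], (attackDesc role d).encode⟩ a) =
      some (haltList (attackMachine M o role) (attackDesc role d).encode) :=
    congrArg some (haltList_attackMachine M o role _)
  -- With `X = (d.encode.length + 1) ^ 2`, translation takes `100 * X` steps, reversal at most `200
  -- * X + 1`, and halting one more; `400 * X` covers this.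
  refine ((h₁.trans h₃).trans (Within.single h₄)).mono ?_
  simp only [List.length_nil] at hlen
  have : 1 ≤ (d.encode.length + 1) ^ 2 := Nat.one_le_pow _ _ (Nat.succ_pos _)
  generalize (d.encode.length + 1) ^ 2 = X at *
  omega

theorem exists_length_output_le :
    ∃ D, ∀ (s : List (M.Γ M.k₀)) (W : List Letter) (k : ℕ),
      (flip bind M.step)^[k] (some (initList M s)) = some (haltList M (W.map o.symm)) →
        W.length ≤ s.length + k * D := by
  let := M.ΛFin
  refine ⟨∑ l, pushes (M.m l), fun s W k h => ?_⟩
  have h₁ := length_iterate_step_le (M := M.m) (D := ∑ l, pushes (M.m l))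
    (fun l => Finset.single_le_sum (f := fun l => pushes (M.m l)) (fun _ _ => Nat.zero_le _)
      (Finset.mem_univ l)) h M.k₁
  rw [haltList_stk, wordStk_self, List.length_map] at h₁
  exact h₁.trans (Nat.add_le_add_right (length_initList_stk_le M s _) _)

end Correctness

theorem length_unaryEncodeNat (n : ℕ) : (Computability.unaryEncodeNat n).length = n :=
  Computability.unary_decode_encode_nat n

/-- The description of the attack on a commitment scheme is written down in polynomial time. -/
theorem CommitmentScheme.polyTime_attackDesc (S : CommitmentScheme) (role : Bool) :
    PolyTime AlgDesc.encode fun n => attackDesc role (S.desc n) := by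
  obtain ⟨h⟩ := S.polyTime
  obtain ⟨D, hD⟩ := exists_length_output_le h.tm h.outputAlphabet
  refine ⟨{ tm := attackMachine h.tm h.outputAlphabet role
            inputAlphabet := h.inputAlphabet
            outputAlphabet := Equiv.refl _
            -- The polynomial `X + h.time * D` bounds the length of the scheme's description: input
            -- length plus at most `D` pushes per step.
            time := h.time + 400 * (Polynomial.X + h.time * Polynomial.C D + 1) ^ 2
            outputsFun := fun n => Classical.choice ?_ }⟩
  obtain ⟨⟨k, hk⟩, hkm⟩ := h.outputsFun n
  have h₁ := within_attackMachine h.tm h.outputAlphabet role (d := S.desc n) hk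
  have h₂ := hD _ _ k hk
  rw [List.length_map, length_unaryEncodeNat] at h₂
  rw [length_unaryEncodeNat] at hkm
  simp only at hkm
  have h₃ := h₁.mono (n := (h.time + 400 * (Polynomial.X + h.time * Polynomial.C D + 1) ^ 2).eval n)
    (by
      simp only [Polynomial.eval_add, Polynomial.eval_mul, Polynomial.eval_pow, Polynomial.eval_X,
        Polynomial.eval_C, Polynomial.eval_one, Polynomial.eval_ofNat]
      have : k * D ≤ h.time.eval n * D := Nat.mul_le_mul_right D hkm
      gcongr
      omega)
  obtain ⟨j, hj, hj'⟩ := h₃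
  rw [length_unaryEncodeNat]
  refine ⟨⟨⟨j, ?_⟩, hj⟩⟩
  refine hj'.trans (congrArg (fun w => some (haltList _ w)) ?_)
  exact (List.map_id _).symm

end QBC

theorem mainTheorem10 :
    (¬ ∃ S : QBC.CommitmentScheme, QBC.IsLogarithmic S.commitLength ∧
      S.ComputationallyBinding ∧ S.ComputationallyHiding) ∧
    (¬ ∃ S : QBC.CommitmentScheme, QBC.IsLogarithmic S.revealLength ∧
      S.ComputationallyBinding ∧ S.ComputationallyHiding) :=
  ⟨fun ⟨S, hl, hb, hh⟩ => S.not_binding_and_hiding S.polyTime_attackDesc hl (Or.inl rfl) hb hh,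
    fun ⟨S, hl, hb, hh⟩ => S.not_binding_and_hiding S.polyTime_attackDesc hl (Or.inr rfl) hb hh⟩
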